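/- Let $(M,J)$ be a compact connected complex surface, and let $\mathfrak t\subset\mathfrak X(M)$ be a $2$-dimensional abelian Lie algebra of smooth real vector fields which are holomorphic (i.e. $\mathcal L_VJ=0$ for all $V\in\mathfrak t$), which is $J$-invariant ($J\mathfrak t=\mathfrak t$) and free (for every $x\in M$ the evaluation map $\mathfrak t\to T_xM$ is injective). Fix a basis $(V_1,V_2)$ of $\mathfrak t$ with $JV_1=V_2$. Let $g$ be a Hermitian metric on $(M,J)$ that is $\mathfrak t$-invariant ($\mathcal L_Vg=0$ for all $V\in\mathfrak t$), with fundamental form $\omega=g(J\cdot,\cdot)$, and assume that $g$ is not Kähler, i.e. that $\mathrm d\omega$ does not vanish identically. Let $\mu_1,\mu_2$ be the real $1$-forms determined by $\mu_i(V_j)=\delta_{ij}$ and $\mu_i(X)=0$ for all $X$ $g$-orthogonal to $V_1,V_2$. Let $\lambda=g(JV_1,V_2)=g(V_1,V_1)$, and let $\check\omega=\omega-\lambda\,\mu_1\wedge\mu_2$, the restriction of $\omega$ to the orthogonal complement of $\langle V_1,V_2\rangle$, extended by zero. Then there are unique functions $\sigma_1,\sigma_2:M\to\mathbb R$ with $$\mathrm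 d\mu_1=\sigma_1\,\check\omega,\qquad \mathrm d\mu_2=\sigma_2\,\check\omega,$$ they are smooth, and $$g\ \text{is Vaisman}\iff \lambda,\ \sigma_1\ \text{and}\ \sigma_2\ \text{are constant on } M.$$ Here $g$ is called Vaisman if its Lee form, i.e. the $1$-form $\theta$ with $\mathrm d\omega=\theta\wedge\omega$, vanishes at no point and is parallel for the Levi-Civita connection of $g$. -/

import Mathlib

open Bundle VectorField
open scoped Manifold ContDiff

namespace VaismanSurface

noncomputable section RealManifold

/-! ### Calculus of tensor fields on a real manifold

Tensor fields are families of multilinear maps on the tangent spaces; the exterior derivative and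
the Lie derivative are given by their usual global formulas in terms of smooth vector fields and
the Lie bracket. -/

variable {E : Type*} [NormedAddCommGroup E] [NormedSpace ℝ E]
  {M : Type*} [TopologicalSpace M] [ChartedSpace E M]

variable (E M) in
/-- (Not necessarily smooth) vector fields on `M`. -/
abbrev VField : Type _ := (x : M) → TangentSpace 𝓘(ℝ, E) x

variable (E M) in
/-- (Not necessarily smooth) real `1`-forms on `M`. -/
abbrev OneForm : Type _ := (x : M) → (TangentSpace 𝓘(ℝ, E) x →L[ℝ] ℝ)

variable (E M) in
/-- Families of real functions of two tangent vectors; the `2`-forms below have this type. -/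
abbrev TwoField : Type _ :=
  (x : M) → TangentSpace 𝓘(ℝ, E) x → TangentSpace 𝓘(ℝ, E) x → ℝ

/-- The derivative `X f` of a function `f` along a vector field `X`. -/
def dirDeriv (X : VField E M) (f : M → ℝ) (x : M) : ℝ :=
  mvfderiv 𝓘(ℝ, E) f x (X x)

/-- The Lie bracket `[X, Y]`. -/
def lieBr (X Y : VField E M) : VField E M := mlieBracket 𝓘(ℝ, E) X Y

/-- The exterior derivative of a `1`-form,
`dα(X, Y) = X(α(Y)) - Y(α(X)) - α([X, Y])`. -/
def extDerivOne (α : OneForm E M) (X Y : VField E M) (x : M) : ℝ :=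
  dirDeriv X (fun y => α y (Y y)) x - dirDeriv Y (fun y => α y (X y)) x - α x (lieBr X Y x)

/-- The exterior derivative of a `2`-form,
`dw(X, Y, Z) = X(w(Y, Z)) - Y(w(X, Z)) + Z(w(X, Y)) - w([X, Y], Z) + w([X, Z], Y) - w([Y, Z], X)`.
-/
def extDerivTwo (w : TwoField E M) (X Y Z : VField E M) (x : M) : ℝ :=
  dirDeriv X (fun y => w y (Y y) (Z y)) x - dirDeriv Y (fun y => w y (X y) (Z y)) x
    + dirDeriv Z (fun y => w y (X y) (Y y)) x
    - w x (lieBr X Y x) (Z x) + w x (lieBr X Z x) (Y x) - w x (lieBr Y Z x) (X x)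

/-- The wedge product `θ ∧ w` of a `1`-form and a `2`-form, evaluated on three vector fields. -/
def wedgeOneTwo (θ : OneForm E M) (w : TwoField E M) (X Y Z : VField E M) (x : M) : ℝ :=
  θ x (X x) * w x (Y x) (Z x) - θ x (Y x) * w x (X x) (Z x) + θ x (Z x) * w x (X x) (Y x)

theorem dirDeriv_smul_left (f : M → ℝ) (X : VField E M) (h : M → ℝ) (x : M) :
    dirDeriv (f • X) h x = f x * dirDeriv X h x := by
  simp [dirDeriv]

theorem dirDeriv_mul (X : VField E M) {f h : M → ℝ} {x : M}
    (hf : MDifferentiableAt 𝓘(ℝ, E) 𝓘(ℝ, ℝ) f x) (hh : MDifferentiableAt 𝓘(ℝ, E) 𝓘(ℝ, ℝ) h x) :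
    dirDeriv X (fun y => f y * h y) x = dirDeriv X f x * h x + f x * dirDeriv X h x := by
  have := mvfderiv_mul hf hh
  simp only [dirDeriv]
  change mvfderiv 𝓘(ℝ, E) (f * h) x (X x) = _
  rw [this]; simp; ring

theorem dirDeriv_add_left (X X' : VField E M) (h : M → ℝ) (x : M) :
    dirDeriv (X + X') h x = dirDeriv X h x + dirDeriv X' h x := by
  simp [dirDeriv]

theorem dirDeriv_add (X : VField E M) {f h : M → ℝ} {x : M}
    (hf : MDifferentiableAt 𝓘(ℝ, E) 𝓘(ℝ, ℝ) f x) (hh : MDifferentiableAt 𝓘(ℝ, E) 𝓘(ℝ, ℝ) h x) :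
    dirDeriv X (fun y => f y + h y) x = dirDeriv X f x + dirDeriv X h x := by
  have := mvfderiv_add hf hh
  simp only [dirDeriv]
  change mvfderiv 𝓘(ℝ, E) (f + h) x (X x) = _
  rw [this]; simp

variable [IsManifold 𝓘(ℝ, E) ∞ M]

/-- Smoothness of a vector field, as a section of the tangent bundle. -/
def IsSmoothField (X : VField E M) : Prop :=
  ContMDiff 𝓘(ℝ, E) 𝓘(ℝ, E).tangent ∞ (fun x => (⟨x, X x⟩ : TangentBundle 𝓘(ℝ, E) M))

/-- Differentiability of a vector field at a point. -/
def DiffFieldAt (X : VField E M) (x : M) : Prop :=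
  MDifferentiableAt 𝓘(ℝ, E) 𝓘(ℝ, E).tangent (fun y => (⟨y, X y⟩ : TangentBundle 𝓘(ℝ, E) M)) x

/-- Smoothness of a `1`-form, as a section of the cotangent bundle. -/
def IsSmoothForm (α : OneForm E M) : Prop :=
  ContMDiff 𝓘(ℝ, E) (𝓘(ℝ, E).prod 𝓘(ℝ, E →L[ℝ] ℝ)) ∞
    (fun x => TotalSpace.mk' (E →L[ℝ] ℝ)
      (E := fun x : M => (TangentSpace 𝓘(ℝ, E) x →L[ℝ] ℝ)) x (α x))

variable (E M) in
/-- Smooth Riemannian metrics on `M`. -/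
abbrev Metric : Type _ :=
  ContMDiffRiemannianMetric 𝓘(ℝ, E) ∞ E (fun x : M => TangentSpace 𝓘(ℝ, E) x)

variable (E M) in
/-- Connections on the tangent bundle of `M`. In Mathlib's convention `nabla Y x u` is
`(∇_u Y)(x)`. -/
abbrev Connection : Type _ :=
  CovariantDerivative 𝓘(ℝ, E) E (TangentSpace 𝓘(ℝ, E) : M → Type _)

/-- `nabla` is the Levi-Civita connection of `g`: it is torsion-free and `g` is parallel. -/
def IsLeviCivita [FiniteDimensional ℝ E] (g : Metric E M) (nabla : Connection E M) : Prop :=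
  haveI : CompleteSpace E := FiniteDimensional.complete ℝ E
  nabla.torsion = 0 ∧
  ∀ (x : M) (X Y Z : VField E M), DiffFieldAt Y x → DiffFieldAt Z x →
    dirDeriv X (fun y => g.inner y (Y y) (Z y)) x =
      g.inner x (nabla Y x (X x)) (Z x) + g.inner x (Y x) (nabla Z x (X x))

/-- The Koszul expression `2 g(∇_X Y, Z)`. -/
def koszul (g : Metric E M) (X Y Z : VField E M) (x : M) : ℝ :=
  dirDeriv X (fun y => g.inner y (Y y) (Z y)) x + dirDeriv Y (fun y => g.inner y (X y) (Z y)) x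
    - dirDeriv Z (fun y => g.inner y (X y) (Y y)) x
    + g.inner x (lieBr X Y x) (Z x) - g.inner x (lieBr X Z x) (Y x)
    - g.inner x (lieBr Y Z x) (X x)

theorem diff_inner (g : Metric E M) {Y Z : VField E M} {x : M} (hY : DiffFieldAt Y x)
    (hZ : DiffFieldAt Z x) :
    MDifferentiableAt 𝓘(ℝ, E) 𝓘(ℝ, ℝ) (fun y => g.inner y (Y y) (Z y)) x := by
  let _ : RiemannianBundle (fun x : M => TangentSpace 𝓘(ℝ, E) x) := ⟨g.toRiemannianMetric⟩
  have _ : IsContMDiffRiemannianBundle 𝓘(ℝ, E) 1 E (fun x : M => TangentSpace 𝓘(ℝ, E) x) :=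
    ⟨g.inner, g.contMDiff.of_le (by exact_mod_cast le_top), fun _ _ _ ↦ rfl⟩
  exact MDifferentiableAt.inner_bundle (E := fun x : M => TangentSpace 𝓘(ℝ, E) x) hY hZ

theorem diff_extend {x : M} (u : TangentSpace 𝓘(ℝ, E) x) :
    DiffFieldAt (FiberBundle.extend E u : VField E M) x :=
  FiberBundle.mdifferentiableAt_extend ..

theorem inner_ext (g : Metric E M) {x : M} {u v : TangentSpace 𝓘(ℝ, E) x}
    (h : ∀ w, g.inner x u w = g.inner x v w) : u = v := by
  by_contra hne
  have h1 := g.pos x (u - v) (sub_ne_zero.mpr hne)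
  simp only [map_sub, sub_apply, h, sub_self, lt_self_iff_false] at h1

section Sharp
variable [FiniteDimensional ℝ E]

instance instFiniteDimensionalTangentSpace (x : M) : FiniteDimensional ℝ (TangentSpace 𝓘(ℝ, E) x) :=
  inferInstanceAs (FiniteDimensional ℝ E)

theorem exists_sharp (g : Metric E M) (x : M)
    (B : TangentSpace 𝓘(ℝ, E) x →L[ℝ] TangentSpace 𝓘(ℝ, E) x →L[ℝ] ℝ) :
    ∃ A : TangentSpace 𝓘(ℝ, E) x →L[ℝ] TangentSpace 𝓘(ℝ, E) x,
      ∀ u v, 2 * g.inner x (A u) v = B u v := by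
  let flat : TangentSpace 𝓘(ℝ, E) x →ₗ[ℝ] Module.Dual ℝ (TangentSpace 𝓘(ℝ, E) x) :=
    { toFun := fun u => (g.inner x u).toLinearMap
      map_add' := fun u v => by ext w; simp
      map_smul' := fun c v => by ext w; simp }
  have hinj : Function.Injective flat := fun u v huv =>
    inner_ext g fun w => congrArg (fun f => f w) huv
  let e := LinearEquiv.ofInjectiveOfFinrankEq flat hinj Subspace.dual_finrank_eq.symm
  have he : ∀ α v, g.inner x (e.symm α) v = α v := fun α v =>
    congrArg (fun f => f v) (e.apply_symm_apply α)
  let A : TangentSpace 𝓘(ℝ, E) x →ₗ[ℝ] TangentSpace 𝓘(ℝ, E) x :=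
    { toFun := fun u => (2⁻¹ : ℝ) • e.symm (B u).toLinearMap
      map_add' := fun u v => by
        rw [map_add, ContinuousLinearMap.toLinearMap_add, map_add, smul_add]
      map_smul' := fun c v => by
        rw [map_smul, ContinuousLinearMap.toLinearMap_smul, map_smul, smul_comm]; rfl }
  have _ : T2Space (TangentSpace 𝓘(ℝ, E) x) := inferInstanceAs (T2Space E)
  refine ⟨LinearMap.toContinuousLinearMap A, fun u v => ?_⟩
  change 2 * g.inner x ((2⁻¹ : ℝ) • e.symm (B u).toLinearMap) v = B u v
  rw [map_smul, smul_apply, he, smul_eq_mul]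
  simp

end Sharp

section LeviCivita
variable [CompleteSpace E]

theorem lieBr_smul_right {f : M → ℝ} {X Y : VField E M} {x : M}
    (hf : MDifferentiableAt 𝓘(ℝ, E) 𝓘(ℝ, ℝ) f x) (hY : DiffFieldAt Y x) :
    lieBr X (f • Y) x = dirDeriv X f x • Y x + f x • lieBr X Y x := by
  simpa [lieBr, dirDeriv] using! mlieBracket_smul_right (I := 𝓘(ℝ, E)) (V := X) hf hY

theorem lieBr_smul_left {f : M → ℝ} {X Y : VField E M} {x : M}
    (hf : MDifferentiableAt 𝓘(ℝ, E) 𝓘(ℝ, ℝ) f x) (hX : DiffFieldAt X x) :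
    lieBr (f • X) Y x = -(dirDeriv Y f x • X x) + f x • lieBr X Y x := by
  simpa [lieBr, dirDeriv] using! mlieBracket_smul_left (I := 𝓘(ℝ, E)) (W := Y) hf hX

theorem koszul_smul_right (g : Metric E M) {f : M → ℝ} {X Y Z : VField E M} {x : M}
    (hf : MDifferentiableAt 𝓘(ℝ, E) 𝓘(ℝ, ℝ) f x) (hX : DiffFieldAt X x) (hY : DiffFieldAt Y x)
    (hZ : DiffFieldAt Z x) : koszul g X Y (f • Z) x = f x * koszul g X Y Z x := by
  have h1 := dirDeriv_mul X hf (diff_inner g hY hZ)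
  have h2 := dirDeriv_mul Y hf (diff_inner g hX hZ)
  simp only [koszul, lieBr_smul_right hf hZ, dirDeriv_smul_left, Pi.smul_apply', map_smul,
    map_add, add_apply, smul_apply, smul_eq_mul, h1, h2, g.symm x (Z x)]
  ring

theorem koszul_add_right (g : Metric E M) {X Y Z Z' : VField E M} {x : M}
    (hX : DiffFieldAt X x) (hY : DiffFieldAt Y x) (hZ : DiffFieldAt Z x)
    (hZ' : DiffFieldAt Z' x) :
    koszul g X Y (Z + Z') x = koszul g X Y Z x + koszul g X Y Z' x := by
  have h1 := dirDeriv_add X (diff_inner g hY hZ) (diff_inner g hY hZ')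
  have h2 := dirDeriv_add Y (diff_inner g hX hZ) (diff_inner g hX hZ')
  have h3 : lieBr X (Z + Z') x = lieBr X Z x + lieBr X Z' x := mlieBracket_add_right hZ hZ'
  have h4 : lieBr Y (Z + Z') x = lieBr Y Z x + lieBr Y Z' x := mlieBracket_add_right hZ hZ'
  simp only [koszul, h3, h4, dirDeriv_add_left, Pi.add_apply, map_add, add_apply, h1, h2]
  ring

theorem koszul_smul_left (g : Metric E M) {f : M → ℝ} {X Y Z : VField E M} {x : M}
    (hf : MDifferentiableAt 𝓘(ℝ, E) 𝓘(ℝ, ℝ) f x) (hX : DiffFieldAt X x) (hY : DiffFieldAt Y x)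
    (hZ : DiffFieldAt Z x) : koszul g (f • X) Y Z x = f x * koszul g X Y Z x := by
  have h1 := dirDeriv_mul Y hf (diff_inner g hX hZ)
  have h2 := dirDeriv_mul Z hf (diff_inner g hX hY)
  simp only [koszul, lieBr_smul_left hf hX, dirDeriv_smul_left, Pi.smul_apply', map_smul,
    map_add, map_neg, add_apply, neg_apply, smul_apply, smul_eq_mul, h1, h2]
  ring

theorem koszul_add_left (g : Metric E M) {X X' Y Z : VField E M} {x : M}
    (hX : DiffFieldAt X x) (hX' : DiffFieldAt X' x) (hY : DiffFieldAt Y x)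
    (hZ : DiffFieldAt Z x) :
    koszul g (X + X') Y Z x = koszul g X Y Z x + koszul g X' Y Z x := by
  have h1 := dirDeriv_add Y (diff_inner g hX hZ) (diff_inner g hX' hZ)
  have h2 := dirDeriv_add Z (diff_inner g hX hY) (diff_inner g hX' hY)
  have h3 : lieBr (X + X') Y x = lieBr X Y x + lieBr X' Y x := mlieBracket_add_left hX hX'
  have h4 : lieBr (X + X') Z x = lieBr X Z x + lieBr X' Z x := mlieBracket_add_left hX hX'
  simp only [koszul, h3, h4, dirDeriv_add_left, Pi.add_apply, map_add, add_apply, h1, h2]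
  ring

theorem koszul_smul_mid (g : Metric E M) {f : M → ℝ} {X Y Z : VField E M} {x : M}
    (hf : MDifferentiableAt 𝓘(ℝ, E) 𝓘(ℝ, ℝ) f x) (hX : DiffFieldAt X x) (hY : DiffFieldAt Y x)
    (hZ : DiffFieldAt Z x) : koszul g X (f • Y) Z x =
      f x * koszul g X Y Z x + 2 * dirDeriv X f x * g.inner x (Y x) (Z x) := by
  have h1 := dirDeriv_mul X hf (diff_inner g hY hZ)
  have h2 := dirDeriv_mul Z hf (diff_inner g hX hY)
  simp only [koszul, lieBr_smul_left hf hY, lieBr_smul_right hf hY, dirDeriv_smul_left,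
    Pi.smul_apply', map_smul, map_add, map_neg, add_apply, neg_apply, smul_apply, smul_eq_mul,
    h1, h2, g.symm x (Y x) (X x)]
  ring

theorem koszul_add_mid (g : Metric E M) {X Y Y' Z : VField E M} {x : M}
    (hX : DiffFieldAt X x) (hY : DiffFieldAt Y x) (hY' : DiffFieldAt Y' x)
    (hZ : DiffFieldAt Z x) :
    koszul g X (Y + Y') Z x = koszul g X Y Z x + koszul g X Y' Z x := by
  have h1 := dirDeriv_add X (diff_inner g hY hZ) (diff_inner g hY' hZ)
  have h2 := dirDeriv_add Z (diff_inner g hX hY) (diff_inner g hX hY')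
  have h3 : lieBr X (Y + Y') x = lieBr X Y x + lieBr X Y' x := mlieBracket_add_right hY hY'
  have h4 : lieBr (Y + Y') Z x = lieBr Y Z x + lieBr Y' Z x := mlieBracket_add_left hY hY'
  simp only [koszul, h3, h4, dirDeriv_add_left, Pi.add_apply, map_add, add_apply, h1, h2]
  ring

variable [FiniteDimensional ℝ E]

/-- The Koszul expression as a bilinear form in the first and the last argument. -/
def koszulForm (g : Metric E M) (Y : VField E M) (x : M) (hY : DiffFieldAt Y x) :
    TangentSpace 𝓘(ℝ, E) x →L[ℝ] TangentSpace 𝓘(ℝ, E) x →L[ℝ] ℝ :=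
  TensorialAt.mkHom₂ (I := 𝓘(ℝ, E)) (F := E) (F' := E) (fun X Z => koszul g X Y Z x) x
    (fun _ hZ => ⟨fun hf hX => koszul_smul_left g hf hX hY hZ,
      fun hX hX' => koszul_add_left g hX hX' hY hZ⟩)
    (fun _ hX => ⟨fun hf hZ => koszul_smul_right g hf hX hY hZ,
      fun hZ hZ' => koszul_add_right g hX hY hZ hZ'⟩)

theorem koszulForm_apply (g : Metric E M) {X Y Z : VField E M} {x : M} (hX : DiffFieldAt X x)
    (hY : DiffFieldAt Y x) (hZ : DiffFieldAt Z x) :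
    koszulForm g Y x hY (X x) (Z x) = koszul g X Y Z x :=
  TensorialAt.mkHom₂_apply _ _ hX hZ

/-- The Koszul identity (in particular, the Levi-Civita connection is unique). -/
theorem IsLeviCivita.two_mul_inner {g : Metric E M} {nabla : Connection E M}
    (h : IsLeviCivita g nabla) {X Y Z : VField E M} {x : M} (hX : DiffFieldAt X x)
    (hY : DiffFieldAt Y x) (hZ : DiffFieldAt Z x) :
    2 * g.inner x (nabla Y x (X x)) (Z x) = koszul g X Y Z x := by
  obtain ⟨ht, hm⟩ := h
  have tor : ∀ {U V : VField E M}, DiffFieldAt U x → DiffFieldAt V x →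
      lieBr U V x = nabla V x (U x) - nabla U x (V x) := by
    intro U V hU hV
    have := nabla.torsion_apply hU hV
    rw [ht] at this
    exact (sub_eq_zero.mp this.symm).symm
  simp only [koszul, hm x _ _ _ hY hZ, hm x _ _ _ hX hZ, hm x _ _ _ hX hY, tor hX hY, tor hX hZ,
    tor hY hZ, map_sub, sub_apply]
  rw [g.symm x (X x) (nabla Z x (Y x)), g.symm x (Y x) (nabla Z x (X x)),
    g.symm x (X x) (nabla Y x (Z x))]
  ring

/-- A Riemannian metric has a Levi-Civita connection. -/
theorem exists_isLeviCivita (g : Metric E M) : ∃ nabla : Connection E M, IsLeviCivita g nabla := by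
  classical
  choose A hA using fun (x : M) => exists_sharp g x
  let D : VField E M → ((x : M) → TangentSpace 𝓘(ℝ, E) x →L[ℝ] TangentSpace 𝓘(ℝ, E) x) :=
    fun Y x => if hY : DiffFieldAt Y x then A x (koszulForm g Y x hY) else 0
  have hD : ∀ (x : M) (X Y Z : VField E M), DiffFieldAt X x → DiffFieldAt Y x → DiffFieldAt Z x →
      2 * g.inner x (D Y x (X x)) (Z x) = koszul g X Y Z x := by
    intro x X Y Z hX hY hZ
    simp only [D, hY, dif_pos, hA]
    exact koszulForm_apply g hX hY hZ
  have hD' : ∀ (x : M) (Y : VField E M) (u w : TangentSpace 𝓘(ℝ, E) x), DiffFieldAt Y x →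
      2 * g.inner x (D Y x u) w =
        koszul g (FiberBundle.extend E u) Y (FiberBundle.extend E w) x := by
    intro x Y u w hY
    simpa using hD x _ Y _ (diff_extend u) hY (diff_extend w)
  let nabla : Connection E M :=
    { toFun := D
      isCovariantDerivativeOnUniv :=
        { add := by
            intro Y Y' x hY hY' _
            ext u
            refine inner_ext g fun w => ?_
            have h1 := hD' x _ u w (mdifferentiableAt_add_section hY hY' : DiffFieldAt (Y + Y') x)
            rw [koszul_add_mid g (diff_extend u) hY hY' (diff_extend w), ← hD' x Y u w hY,
              ← hD' x Y' u w hY'] at h1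
            simp only [add_apply, map_add]
            linarith
          leibniz := by
            intro Y f x hY hf _
            ext u
            refine inner_ext g fun w => ?_
            have h1 := hD' x _ u w (hf.smul_section hY : DiffFieldAt (f • Y) x)
            rw [koszul_smul_mid g hf (diff_extend u) hY (diff_extend w), ← hD' x Y u w hY] at h1
            simp only [add_apply, map_add, smul_apply, map_smul, smul_eq_mul,
              ContinuousLinearMap.smulRight_apply]
            simp only [dirDeriv, FiberBundle.extend_apply_self] at h1
            linarith } }
  have hn : ∀ (x : M) (X Y Z : VField E M), DiffFieldAt X x → DiffFieldAt Y x → DiffFieldAt Z x →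
      2 * g.inner x (nabla Y x (X x)) (Z x) = koszul g X Y Z x := hD
  refine ⟨nabla, ?_, ?_⟩
  · ext x u v
    refine inner_ext g fun w => ?_
    have h1 := nabla.torsion_apply (diff_extend (M := M) u) (diff_extend v)
    have h2 := hn x _ _ _ (diff_extend u) (diff_extend v) (diff_extend w)
    have h3 := hn x _ _ _ (diff_extend v) (diff_extend u) (diff_extend w)
    simp only [FiberBundle.extend_apply_self] at h1 h2 h3
    rw [h1]
    change g.inner x (_ - _ - lieBr _ _ x) w = g.inner x 0 w
    simp only [koszul, FiberBundle.extend_apply_self] at h2 h3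
    have h4 : lieBr (FiberBundle.extend E v) (FiberBundle.extend E u) x =
        -lieBr (FiberBundle.extend E u) (FiberBundle.extend E v : VField E M) x :=
      mlieBracket_swap_apply
    simp only [h4, map_neg, neg_apply, g.symm _ (FiberBundle.extend E v _)
      (FiberBundle.extend E u _)] at h3
    simp only [map_sub, sub_apply, map_zero, zero_apply]
    linarith
  · intro x X Y Z hY hZ
    have h2 := hn x _ _ _ (diff_extend (X x)) hY hZ
    have h3 := hn x _ _ _ (diff_extend (X x)) hZ hY
    have h4 : lieBr Z Y x = -lieBr Y Z x := mlieBracket_swap_apply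
    have h5 : ∀ f : M → ℝ, dirDeriv (FiberBundle.extend E (X x)) f x = dirDeriv X f x := by
      intro f; simp [dirDeriv]
    simp only [koszul, h4, h5, FiberBundle.extend_apply_self, map_neg, neg_apply,
      g.symm _ (Z _) (Y _)] at h2 h3
    rw [g.symm x (Y x)]
    linarith

end LeviCivita
/-- The `1`-form `θ` is parallel for the Levi-Civita connection `∇` of `g`, i.e.
`(∇_X θ)(Y) = X(θ(Y)) - θ(∇_X Y)` vanishes for all vector fields `X`, `Y`. -/
def IsParallelForm [FiniteDimensional ℝ E] (g : Metric E M) (θ : OneForm E M) : Prop :=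
  ∃ nabla : Connection E M, IsLeviCivita g nabla ∧
    ∀ X Y : VField E M, IsSmoothField X → IsSmoothField Y → ∀ x : M,
      dirDeriv X (fun y => θ y (Y y)) x = θ x (nabla Y x (X x))

/-- The equation `dα = σ w` of `2`-forms, evaluated on all smooth vector fields. -/
def ExtDerivEq (α : OneForm E M) (σ : M → ℝ) (w : TwoField E M) : Prop :=
  ∀ X Y : VField E M, IsSmoothField X → IsSmoothField Y → ∀ x : M,
    extDerivOne α X Y x = σ x * w x (X x) (Y x)

end RealManifold

noncomputable section ComplexManifold

/-! ### Hermitian metrics on complex manifolds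

`M` is a complex manifold modelled on the complex vector space `E`, also regarded as a real
manifold modelled on the real vector space underlying `E`. -/

variable {E : Type*} [NormedAddCommGroup E] [NormedSpace ℂ E]
  {M : Type*} [TopologicalSpace M] [ChartedSpace E M]

/-- A complex manifold is a real analytic manifold, with the same charts. -/
instance instIsManifoldReal [hM : IsManifold 𝓘(ℂ, E) ω M] : IsManifold 𝓘(ℝ, E) ω M := by
  refine isManifold_of_contDiffOn _ _ _ fun e e' he he' => ?_
  have h := (contDiffGroupoid ω 𝓘(ℂ, E)).compatible he he'
  rw [contDiffGroupoid, mem_groupoid_of_pregroupoid] at h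
  exact (h.1 : ContDiffOn ℂ ω _ _).restrict_scalars ℝ

/-- The complex structure `J` of `M`: multiplication by `i` on the tangent spaces, which are
complex vector spaces because the coordinate changes are holomorphic. -/
def J (x : M) : TangentSpace 𝓘(ℝ, E) x →L[ℝ] TangentSpace 𝓘(ℝ, E) x :=
  (Complex.I • ContinuousLinearMap.id ℝ E : E →L[ℝ] E)

/-- The vector field `J X`. -/
def JField (X : VField E M) : VField E M := fun x => J x (X x)

theorem J_J (x : M) (u : TangentSpace 𝓘(ℝ, E) x) : J x (J x u) = -u := by
  have h : ∀ v : E, Complex.I • Complex.I • v = -v := fun v => by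
    rw [smul_smul, Complex.I_mul_I, neg_one_smul]
  exact h u

variable [IsManifold 𝓘(ℂ, E) ω M]

/-- The Riemannian metric `g` is Hermitian: `g(J u, J v) = g(u, v)`. -/
def IsHermitianMetric (g : Metric E M) : Prop :=
  ∀ (x : M) (u v : TangentSpace 𝓘(ℝ, E) x), g.inner x (J x u) (J x v) = g.inner x u v

/-- The fundamental form `ω = g(J ·, ·)`. -/
def fundForm (g : Metric E M) : TwoField E M := fun x u v => g.inner x (J x u) v

/-- The Hermitian metric `g` is Kähler: `dω = 0`. -/
def IsKaehler (g : Metric E M) : Prop :=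
  ∀ X Y Z : VField E M, IsSmoothField X → IsSmoothField Y → IsSmoothField Z → ∀ x : M,
    extDerivTwo (fundForm g) X Y Z x = 0

/-- On a complex surface, `θ` is the Lee form of `g`: `dω = θ ∧ ω`. -/
def IsLeeForm (g : Metric E M) (θ : OneForm E M) : Prop :=
  IsSmoothForm θ ∧
  ∀ X Y Z : VField E M, IsSmoothField X → IsSmoothField Y → IsSmoothField Z → ∀ x : M,
    extDerivTwo (fundForm g) X Y Z x = wedgeOneTwo θ (fundForm g) X Y Z x

/-- A Hermitian metric on a complex surface is Vaisman if its Lee form is nowhere vanishing and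
parallel for the Levi-Civita connection (the condition `dω = θ ∧ ω / (n - 1)` holds for the Lee
form by definition, as `n = 2`). -/
def IsVaisman [FiniteDimensional ℂ E] (g : Metric E M) : Prop :=
  ∃ θ : OneForm E M, IsLeeForm g θ ∧ (∀ x, θ x ≠ 0) ∧ IsParallelForm g θ

/-- `𝔱` is a free, `J`-invariant, `2`-dimensional abelian algebra of holomorphic (i.e. preserving
`J`) vector fields. -/
structure IsVerticalAlgebra (𝔱 : Submodule ℝ (VField E M)) : Prop where
  smooth : ∀ V ∈ 𝔱, IsSmoothField V
  finrank_eq : Module.finrank ℝ 𝔱 = 2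
  abelian : ∀ V ∈ 𝔱, ∀ W ∈ 𝔱, lieBr V W = 0
  /-- `(𝓛_V J) X = [V, J X] - J [V, X] = 0`. -/
  lieDeriv_J : ∀ V ∈ 𝔱, ∀ X : VField E M, IsSmoothField X → lieBr V (JField X) = JField (lieBr V X)
  /-- The evaluation `𝔱 → T_x M` has maximal rank, i.e. it is injective. -/
  free : ∀ V ∈ 𝔱, ∀ x : M, V x = 0 → V = 0
  J_mem : ∀ V ∈ 𝔱, JField V ∈ 𝔱

/-- `g` is `𝔱`-invariant:
`(𝓛_V g)(X, Y) = V(g(X, Y)) - g([V, X], Y) - g(X, [V, Y]) = 0` for all `V` in `𝔱`. -/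
def IsInvariantMetric (𝔱 : Submodule ℝ (VField E M)) (g : Metric E M) : Prop :=
  ∀ V ∈ 𝔱, ∀ X Y : VField E M, IsSmoothField X → IsSmoothField Y → ∀ x : M,
    dirDeriv V (fun y => g.inner y (X y) (Y y)) x =
      g.inner x (lieBr V X x) (Y x) + g.inner x (X x) (lieBr V Y x)

/-! In the following definitions, `V₂ = J V₁`. -/

/-- The vertical length `λ = ω(V₁, V₂) = g(J V₁, V₂)`. -/
def vertLength (g : Metric E M) (V₁ V₂ : VField E M) (x : M) : ℝ :=
  g.inner x (J x (V₁ x)) (V₂ x)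

/-- The component along `V` of the principal connection `μ = μ₁ ⊗ V₁ + μ₂ ⊗ V₂` induced by `g`,
for `V = V₁, V₂`. As `V₁`, `V₂` are orthogonal, this is the `1`-form `g(V, ·) / g(V, V)`; see
`connForm_apply` and `hor_orthogonal`. -/
def connForm (g : Metric E M) (V : VField E M) : OneForm E M :=
  fun x => (g.inner x (V x) (V x))⁻¹ • g.inner x (V x)

/-- The horizontal part `u - μ₁(u) V₁ - μ₂(u) V₂` of a tangent vector `u`. -/
def hor (g : Metric E M) (V₁ V₂ : VField E M) (x : M) (u : TangentSpace 𝓘(ℝ, E) x) :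
    TangentSpace 𝓘(ℝ, E) x :=
  u - connForm g V₁ x u • V₁ x - connForm g V₂ x u • V₂ x

/-- The horizontal part `ω̌` of the fundamental form: the restriction of `ω` to the orthogonal
complement of `V₁`, `V₂`, extended by zero to vertical vectors. -/
def horForm (g : Metric E M) (V₁ V₂ : VField E M) : TwoField E M :=
  fun x u v => fundForm g x (hor g V₁ V₂ x u) (hor g V₁ V₂ x v)

theorem inner_J_self {g : Metric E M} (hg : IsHermitianMetric g) (x : M)
    (u : TangentSpace 𝓘(ℝ, E) x) : g.inner x u (J x u) = 0 := by
  have h := hg x u (J x u)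
  rw [J_J, map_neg, g.symm] at h
  linarith

/-- `μ_i(V_j) = δ_ij`. -/
theorem connForm_apply {g : Metric E M} (hg : IsHermitianMetric g) (V : VField E M) (x : M)
    (hV : V x ≠ 0) :
    connForm g V x (V x) = 1 ∧ connForm g V x (J x (V x)) = 0 ∧
      connForm g (JField V) x (V x) = 0 ∧ connForm g (JField V) x (J x (V x)) = 1 := by
  have h := (g.pos x _ hV).ne'
  simp [connForm, JField, hg x, inner_J_self hg, g.symm x (J x (V x)) (V x), h]

/-- The kernel of `μ` is the orthogonal complement of `V₁`, `V₂`. -/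
theorem hor_orthogonal {g : Metric E M} (hg : IsHermitianMetric g) (V : VField E M) (x : M)
    (hV : V x ≠ 0) (u : TangentSpace 𝓘(ℝ, E) x) :
    g.inner x (hor g V (JField V) x u) (V x) = 0 ∧
      g.inner x (hor g V (JField V) x u) (J x (V x)) = 0 := by
  have h := (g.pos x _ hV).ne'
  constructor <;>
  simp [hor, connForm, JField, hg x, inner_J_self hg, g.symm x (J x (V x)) (V x), g.symm x u] <;>
  field_simp <;> ring

end ComplexManifold
end VaismanSurface

open VaismanSurface

/-!
Write `λ = g(V₁, V₁)`, and let `X`, `Y` be vector fields.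

*Curvature.* The forms `μᵢ` are `𝔱`-invariant and have constant values on `V₁`, `V₂`, so `dμᵢ`
vanishes on vertical vectors. As the horizontal distribution is a plane, spanned by `e`, `J e`, the
form `dμᵢ` is a multiple `σᵢ` of `ω̌` (`exists_curvature`), and `σᵢ` is invariant
(`dirDeriv_curvature`). Tensoriality is used throughout in the form of `IsTensorAt.expand`: a
`C^∞(M)`-linear expression is determined by its values on the frame `V₁, V₂, e, J e`.

*Lee form.* Since `𝓛_Z ω = 0` for `Z` in `𝔱`, Cartan's formula gives `ι_Z dω = -d(ι_Z ω)`, and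
`ι_{V₁} ω = λ μ₂`, `ι_{V₂} ω = -λ μ₁`. Comparing with `θ ∧ ω` yields `θ(V₁) = -λ σ₂`,
`θ(V₂) = λ σ₁` (`leeForm_vertical`) and `dλ = λ θ - θ(V₁) g(V₁, ·) - θ(V₂) g(V₂, ·)`
(`dirDeriv_normSq_eq`), that is, `θ = λ (σ₁ μ₂ - σ₂ μ₁) + d log λ`.

*Vaisman implies constant* (`const_of_parallel_leeForm`). As `V₁` is Killing, `∇_{V₁} V₁` is
`-½ grad λ`, which is horizontal. If `θ` is parallel, then `θ(∇_{V₁} V₁) = V₁(θ(V₁))`; the right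
hand side is zero since `θ(V₁) = -λ σ₂` is invariant, and the left hand side is
`-½ |grad λ|² / λ`. So `λ` is constant, and `θ` vanishes on horizontal vectors. Then `∇_X Vᵢ` is
horizontal, so `X(θ(Vᵢ)) = θ(∇_X Vᵢ) = 0`, and `λ σ₁`, `λ σ₂` are constant on the connected
manifold `M`.

*Constant implies Vaisman* (`isVaisman_of_const`). The Lee form is dual to the Killing field
`T = σ₁ V₂ - σ₂ V₁` and closed, as `dθ = λ (σ₁ σ₂ - σ₂ σ₁) ω̌ = 0`; a Killing field with closed
dual form is parallel. It has no zeros unless `σ₁ = σ₂ = 0`, and then `dω = 0`.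
-/

namespace VaismanSurface

noncomputable section SmoothCalculus

/-! ### Smooth vector fields, functions and forms -/

variable {E : Type*} [NormedAddCommGroup E] [NormedSpace ℝ E]
  {M : Type*} [TopologicalSpace M] [ChartedSpace E M]

theorem dirDeriv_const (X : VField E M) (c : ℝ) (x : M) : dirDeriv X (fun _ => c) x = 0 := by
  simp [dirDeriv, mvfderiv_const]

theorem dirDeriv_sub (X : VField E M) {f h : M → ℝ} {x : M}
    (hf : MDifferentiableAt 𝓘(ℝ, E) 𝓘(ℝ, ℝ) f x) (hh : MDifferentiableAt 𝓘(ℝ, E) 𝓘(ℝ, ℝ) h x) :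
    dirDeriv X (fun y => f y - h y) x = dirDeriv X f x - dirDeriv X h x := by
  have := mvfderiv_sub hf hh
  simp only [dirDeriv]
  change mvfderiv 𝓘(ℝ, E) (f - h) x (X x) = _
  rw [this]; simp

theorem dirDeriv_const_mul (X : VField E M) (c : ℝ) {f : M → ℝ} {x : M}
    (hf : MDifferentiableAt 𝓘(ℝ, E) 𝓘(ℝ, ℝ) f x) :
    dirDeriv X (fun y => c * f y) x = c * dirDeriv X f x := by
  rw [dirDeriv_mul X mdifferentiableAt_const hf, dirDeriv_const]; ring

theorem lieBr_swap (X Y : VField E M) (x : M) : lieBr X Y x = -lieBr Y X x :=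
  mlieBracket_swap_apply

theorem lieBr_self (X : VField E M) : lieBr X X = 0 := mlieBracket_self

theorem smooth_diff {f : M → ℝ} (hf : ContMDiff 𝓘(ℝ, E) 𝓘(ℝ, ℝ) ∞ f) (x : M) :
    MDifferentiableAt 𝓘(ℝ, E) 𝓘(ℝ, ℝ) f x :=
  (hf x).mdifferentiableAt (by simp)

variable [IsManifold 𝓘(ℝ, E) ∞ M]

theorem IsSmoothField.diff {X : VField E M} (hX : IsSmoothField X) (x : M) : DiffFieldAt X x :=
  (hX x).mdifferentiableAt (by simp)

theorem IsSmoothField.add {X Y : VField E M} (hX : IsSmoothField X) (hY : IsSmoothField Y) :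
    IsSmoothField (X + Y) := ContMDiff.add_section hX hY

theorem IsSmoothField.sub {X Y : VField E M} (hX : IsSmoothField X) (hY : IsSmoothField Y) :
    IsSmoothField (X - Y) := ContMDiff.sub_section hX hY

theorem IsSmoothField.smul {f : M → ℝ} {X : VField E M} (hf : ContMDiff 𝓘(ℝ, E) 𝓘(ℝ, ℝ) ∞ f)
    (hX : IsSmoothField X) : IsSmoothField (f • X) := ContMDiff.smul_section hf hX

theorem IsSmoothField.inner (g : Metric E M) {X Y : VField E M} (hX : IsSmoothField X)
    (hY : IsSmoothField Y) :
    ContMDiff 𝓘(ℝ, E) 𝓘(ℝ, ℝ) ∞ (fun y => g.inner y (X y) (Y y)) := by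
  let _ : RiemannianBundle (fun x : M => TangentSpace 𝓘(ℝ, E) x) := ⟨g.toRiemannianMetric⟩
  have _ : IsContMDiffRiemannianBundle 𝓘(ℝ, E) ∞ E (fun x : M => TangentSpace 𝓘(ℝ, E) x) :=
    ⟨g.inner, g.contMDiff, fun _ _ _ ↦ rfl⟩
  exact ContMDiff.inner_bundle (E := fun x : M => TangentSpace 𝓘(ℝ, E) x) hX hY

theorem IsSmoothField.dirDeriv {X : VField E M} (hX : IsSmoothField X) {f : M → ℝ}
    (hf : ContMDiff 𝓘(ℝ, E) 𝓘(ℝ, ℝ) ∞ f) :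
    ContMDiff 𝓘(ℝ, E) 𝓘(ℝ, ℝ) ∞ (dirDeriv X f) := by
  have h1 := hf.contMDiff_tangentMap (m := ∞) (by simp)
  have h2 := (contMDiff_snd_tangentBundle_modelSpace ℝ 𝓘(ℝ, ℝ) (n := ∞)).comp (h1.comp hX)
  exact h2

theorem IsSmoothForm.apply {θ : OneForm E M} (hθ : IsSmoothForm θ) {X : VField E M}
    (hX : IsSmoothField X) : ContMDiff 𝓘(ℝ, E) 𝓘(ℝ, ℝ) ∞ (fun y => θ y (X y)) := by
  have h : ContMDiff 𝓘(ℝ, E) (𝓘(ℝ, E).prod 𝓘(ℝ, ℝ)) ∞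
      (fun m ↦ TotalSpace.mk' ℝ (E := Bundle.Trivial M ℝ) m (θ m (X m))) :=
    ContMDiff.clm_bundle_apply (E₁ := fun x : M => TangentSpace 𝓘(ℝ, E) x) (F₁ := E) hθ hX
  intro x
  have := h x
  simp only [contMDiffAt_totalSpace] at this
  exact this.2

theorem isSmoothForm_inner (g : Metric E M) {X : VField E M} (hX : IsSmoothField X) :
    IsSmoothForm (fun x => g.inner x (X x)) := by
  exact ContMDiff.clm_bundle_apply (E₁ := fun x : M => TangentSpace 𝓘(ℝ, E) x) (F₁ := E)
    (E₂ := fun x : M => (TangentSpace 𝓘(ℝ, E) x →L[ℝ] ℝ)) g.contMDiff hX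

theorem isManifold_minSmoothness_two : IsManifold 𝓘(ℝ, E) (minSmoothness ℝ 2) M :=
  IsManifold.of_le (n := ∞) (by simpa using ENat.LEInfty.out)

theorem IsSmoothField.lieBr [CompleteSpace E] {X Y : VField E M} (hX : IsSmoothField X)
    (hY : IsSmoothField Y) : IsSmoothField (lieBr X Y) := by
  intro x
  have _ : IsManifold 𝓘(ℝ, E) (minSmoothness ℝ 2) M := isManifold_minSmoothness_two
  have _ : IsManifold 𝓘(ℝ, E) (((⊤ : ℕ∞) : ℕ∞ω) + 1) M := inferInstanceAs (IsManifold 𝓘(ℝ, E) ∞ M)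
  exact ContMDiffAt.mlieBracket_vectorField (m := ⊤) (n := ⊤) (hX x) (hY x) (by simp)

theorem jacobi [CompleteSpace E] {X Y Z : VField E M} (hX : IsSmoothField X)
    (hY : IsSmoothField Y) (hZ : IsSmoothField Z) (x : M) :
    lieBr X (lieBr Y Z) x = lieBr (lieBr X Y) Z x + lieBr Y (lieBr X Z) x := by
  have _ : IsManifold 𝓘(ℝ, E) (minSmoothness ℝ 3) M :=
    IsManifold.of_le (n := ∞) (by simpa using ENat.LEInfty.out)
  have h : minSmoothness ℝ 2 ≤ ∞ := by simpa using ENat.LEInfty.out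
  exact leibniz_identity_mlieBracket_apply ((hX x).of_le h) ((hY x).of_le h) ((hZ x).of_le h)

/-- Every tangent vector is the value of a global smooth vector field, by cutting off a local one. -/
theorem exists_smoothField [FiniteDimensional ℝ E] [T2Space M] {x : M}
    (u : TangentSpace 𝓘(ℝ, E) x) : ∃ X : VField E M, IsSmoothField X ∧ X x = u := by
  obtain ⟨s, hs, hsm⟩ := FiberBundle.exists_contMDiffOn_extend (k := ∞) 𝓘(ℝ, E) E u
  obtain ⟨ρ, hρ, -⟩ := ((SmoothBumpFunction.nhds_basis_support (I := 𝓘(ℝ, E))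
    (interior_mem_nhds.2 hs)).mem_iff).1 (interior_mem_nhds.2 hs)
  refine ⟨(ρ : M → ℝ) • (FiberBundle.extend E u : VField E M), ?_, by simp⟩
  exact ContMDiffOn.smul_section_of_tsupport ρ.contMDiff.contMDiffOn isOpen_interior hρ
    (hsm.mono interior_subset)

/-- `[X, Y] f = X (Y f) - Y (X f)`. It is the coefficient of `Z` in the Jacobi identity for
`X`, `Y` and `f Z`. -/
theorem dirDeriv_lieBr [CompleteSpace E] {X Y Z : VField E M} (hX : IsSmoothField X)
    (hY : IsSmoothField Y) (hZ : IsSmoothField Z) {f : M → ℝ}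
    (hf : ContMDiff 𝓘(ℝ, E) 𝓘(ℝ, ℝ) ∞ f) {x : M} (hZx : Z x ≠ 0) :
    dirDeriv (lieBr X Y) f x = dirDeriv X (dirDeriv Y f) x - dirDeriv Y (dirDeriv X f) x := by
  have e : ∀ {A B : VField E M}, IsSmoothField A → IsSmoothField B →
      lieBr A (f • B) = dirDeriv A f • B + f • lieBr A B := fun hA hB =>
    funext fun y => lieBr_smul_right (smooth_diff hf y) (hB.diff y)
  have a : ∀ {A B C : VField E M}, IsSmoothField B → IsSmoothField C →
      lieBr A (B + C) x = lieBr A B x + lieBr A C x := fun hB hC =>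
    mlieBracket_add_right (hB.diff x) (hC.diff x)
  have h1 := jacobi hX hY (hZ.smul hf) x
  have h2 := jacobi hX hY hZ x
  rw [e hY hZ, e hX hZ, e (hX.lieBr hY) hZ, a (hZ.smul (hY.dirDeriv hf)) ((hY.lieBr hZ).smul hf),
    a (hZ.smul (hX.dirDeriv hf)) ((hX.lieBr hZ).smul hf), e hX (hY.lieBr hZ), e hY (hX.lieBr hZ),
    lieBr_smul_right (smooth_diff (hY.dirDeriv hf) x) (hZ.diff x),
    lieBr_smul_right (smooth_diff (hX.dirDeriv hf) x) (hZ.diff x)] at h1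
  simp only [Pi.add_apply, Pi.smul_apply', h2] at h1
  -- All other terms of the Leibniz expansion cancel, leaving a multiple of `Z x ≠ 0`.
  have h3 : (dirDeriv (lieBr X Y) f x -
      (dirDeriv X (dirDeriv Y f) x - dirDeriv Y (dirDeriv X f) x)) • Z x = 0 := by
    rw [← sub_eq_zero] at h1
    rw [← neg_eq_zero, ← h1]
    module
  exact sub_eq_zero.1 ((smul_eq_zero.1 h3).resolve_right hZx)

theorem eq_const_of_dirDeriv_eq_zero [FiniteDimensional ℝ E] [T2Space M] [ConnectedSpace M]
    {f : M → ℝ} (hf : ContMDiff 𝓘(ℝ, E) 𝓘(ℝ, ℝ) ∞ f)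
    (h : ∀ X : VField E M, IsSmoothField X → ∀ x, dirDeriv X f x = 0) :
    ∃ c : ℝ, ∀ x, f x = c := by
  have h0 : ∀ x, HasMFDerivAt 𝓘(ℝ, E) 𝓘(ℝ, ℝ) f x 0 := by
    intro x
    have h1 := (smooth_diff hf x).hasMFDerivAt
    convert h1 using 1
    ext u
    obtain ⟨X, hX, rfl⟩ := exists_smoothField (M := M) (x := x) u
    exact (h X hX x).symm
  have hloc : IsLocallyConstant f := by
    rw [IsLocallyConstant.iff_eventually_eq]
    intro x
    let φ := extChartAt 𝓘(ℝ, E) x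
    have hopen : IsOpen φ.target := isOpen_extChartAt_target x
    obtain ⟨r, hr, hb⟩ := Metric.isOpen_iff.1 hopen (φ x) (mem_extChartAt_target x)
    have hd : ∀ y ∈ Metric.ball (φ x) r, HasFDerivAt (f ∘ φ.symm) (0 : E →L[ℝ] ℝ) y := by
      intro y hy
      have h1 : MDifferentiableAt 𝓘(ℝ, E) 𝓘(ℝ, E) φ.symm y :=
        ((contMDiffOn_extChartAt_symm (n := ∞) x).mdifferentiableOn (by simp) y
          (hb hy)).mdifferentiableAt (hopen.mem_nhds (hb hy))
      have h2 := (h0 (φ.symm y)).comp y h1.hasMFDerivAt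
      rw [ContinuousLinearMap.zero_comp] at h2
      exact h2.hasFDerivAt
    have hc : ∀ y ∈ Metric.ball (φ x) r, f (φ.symm y) = f (φ.symm (φ x)) := fun y hy =>
      (convex_ball (φ x) r).is_const_of_fderivWithin_eq_zero (𝕜 := ℝ)
        (fun z hz => (hd z hz).differentiableAt.differentiableWithinAt)
        (fun z hz => ((hd z hz).hasFDerivWithinAt).fderivWithin
          (Metric.isOpen_ball.uniqueDiffWithinAt hz)) hy (Metric.mem_ball_self hr)
    filter_upwards [(continuousAt_extChartAt (I := 𝓘(ℝ, E)) x).preimage_mem_nhds (Metric.ball_mem_nhds _ hr),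
      extChartAt_source_mem_nhds (I := 𝓘(ℝ, E)) x] with y hy hy'
    have := hc _ hy
    rwa [φ.left_inv hy', φ.left_inv (mem_extChartAt_source x)] at this
  obtain ⟨x₀⟩ := ‹ConnectedSpace M›.toNonempty
  exact ⟨f x₀, fun x => hloc.apply_eq_of_isPreconnected isPreconnected_univ trivial trivial⟩

end SmoothCalculus

noncomputable section AdaptedFrame

/-! ### Invariant Hermitian metrics and adapted frames -/

variable {E : Type*} [NormedAddCommGroup E] [NormedSpace ℂ E]
  {M : Type*} [TopologicalSpace M] [ChartedSpace E M] [IsManifold 𝓘(ℂ, E) ω M]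

/-- `J` preserves smoothness: coordinate changes are holomorphic, so multiplication by `i` commutes
with their derivatives and is constant in the trivializations of the tangent bundle. -/
theorem IsSmoothField.JField {X : VField E M} (hX : IsSmoothField X) :
    IsSmoothField (JField X) := by
  intro x₀
  have h := (contMDiffAt_section _).1 (hX x₀)
  refine (contMDiffAt_section _).2 (((ContinuousLinearMap.contDiff
    (Complex.I • ContinuousLinearMap.id ℝ E : E →L[ℝ] E)).contMDiff.contMDiffAt.comp x₀
      h).congr_of_eventuallyEq ?_)
  filter_upwards [(chartAt E x₀).open_source.mem_nhds (mem_chart_source E x₀)] with x hx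
  simp only [TangentBundle.trivializationAt_apply, Function.comp_apply]
  have hc : ContDiffOn ℂ ω ((chartAt E x).symm ≫ₕ chartAt E x₀)
      ((chartAt E x).symm ≫ₕ chartAt E x₀).source := by
    have h := (contDiffGroupoid ω 𝓘(ℂ, E)).compatible (chart_mem_atlas E x) (chart_mem_atlas E x₀)
    rw [contDiffGroupoid, mem_groupoid_of_pregroupoid] at h
    simpa [contDiffPregroupoid] using h.1
  have hp : chartAt E x x ∈ ((chartAt E x).symm ≫ₕ chartAt E x₀).source := by
    simp [hx]
  have hd := ((hc.contDiffAt (((chartAt E x).symm ≫ₕ chartAt E x₀).open_source.mem_nhds hp)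
    ).differentiableAt (by simp)).hasFDerivAt.restrictScalars ℝ
  have hd' : fderivWithin ℝ ((chartAt E x₀).extend 𝓘(ℝ, E) ∘ ((chartAt E x).extend 𝓘(ℝ, E)).symm)
      (Set.range 𝓘(ℝ, E)) ((chartAt E x).extend 𝓘(ℝ, E) x) = ContinuousLinearMap.restrictScalars ℝ
        (fderiv ℂ ((chartAt E x).symm ≫ₕ chartAt E x₀) (chartAt E x x)) := by
    have : Set.range 𝓘(ℝ, E) = Set.univ := by simp
    rw [this, fderivWithin_univ]
    exact hd.fderiv
  rw [hd']
  exact map_smul (fderiv ℂ ((chartAt E x).symm ≫ₕ chartAt E x₀) (chartAt E x x)) Complex.I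
    (show E from X x)

/-- The standing situation: `V` and `J V` are commuting vector fields without zeros, which preserve
both `g` and `J`, and `g` is Hermitian. Statements about both fields are made for a field `K` with
`K = V ∨ K = JField V`. -/
structure IsInvariantPair (g : Metric E M) (V : VField E M) : Prop where
  hermitian : IsHermitianMetric g
  smooth : IsSmoothField V
  ne_zero : ∀ x, V x ≠ 0
  lieBr_J : lieBr V (JField V) = 0
  killing : ∀ K, K = V ∨ K = JField V → ∀ X Y : VField E M, IsSmoothField X → IsSmoothField Y →
    ∀ x, dirDeriv K (fun y => g.inner y (X y) (Y y)) x =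
      g.inner x (lieBr K X x) (Y x) + g.inner x (X x) (lieBr K Y x)
  holomorphic : ∀ K, K = V ∨ K = JField V → ∀ X : VField E M, IsSmoothField X →
    lieBr K (JField X) = JField (lieBr K X)

theorem IsHermitianMetric.inner_J_left {g : Metric E M} (hg : IsHermitianMetric g) (x : M)
    (u v : TangentSpace 𝓘(ℝ, E) x) : g.inner x (J x u) v = -g.inner x u (J x v) := by
  rw [← hg x (J x u) v, J_J, map_neg, neg_apply]

theorem IsHermitianMetric.inner_J_self_left {g : Metric E M} (hg : IsHermitianMetric g) (x : M)
    (u : TangentSpace 𝓘(ℝ, E) x) : g.inner x (J x u) u = 0 := by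
  rw [hg.inner_J_left, inner_J_self hg, neg_zero]

namespace IsInvariantPair

variable {g : Metric E M} {V : VField E M}

theorem smooth_of_mem (P : IsInvariantPair g V) {K : VField E M} (hK : K = V ∨ K = JField V) :
    IsSmoothField K := by
  rcases hK with rfl | rfl
  exacts [P.smooth, P.smooth.JField]

theorem lieBr_eq_zero (P : IsInvariantPair g V) {K L : VField E M} (hK : K = V ∨ K = JField V)
    (hL : L = V ∨ L = JField V) : lieBr K L = 0 := by
  rcases hK with rfl | rfl <;> rcases hL with rfl | rfl
  · exact lieBr_self _
  · exact P.lieBr_J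
  · funext x
    rw [lieBr_swap, P.lieBr_J]; simp
  · exact lieBr_self _

theorem inner_self (P : IsInvariantPair g V) {K : VField E M} (hK : K = V ∨ K = JField V)
    (x : M) : g.inner x (K x) (K x) = g.inner x (V x) (V x) := by
  rcases hK with rfl | rfl
  exacts [rfl, P.hermitian x _ _]

theorem pos (P : IsInvariantPair g V) (x : M) : 0 < g.inner x (V x) (V x) :=
  g.pos x _ (P.ne_zero x)

/-- The principal connection forms take constant values on `V` and `J V`. -/
theorem connForm_const (P : IsInvariantPair g V) {K Z : VField E M} (hK : K = V ∨ K = JField V)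
    (hZ : Z = V ∨ Z = JField V) : ∃ c : ℝ, ∀ x, connForm g K x (Z x) = c := by
  rcases hK with rfl | rfl <;> rcases hZ with rfl | rfl
  · exact ⟨1, fun x => (connForm_apply P.hermitian _ x (P.ne_zero x)).1⟩
  · exact ⟨0, fun x => (connForm_apply P.hermitian _ x (P.ne_zero x)).2.1⟩
  · exact ⟨0, fun x => (connForm_apply P.hermitian _ x (P.ne_zero x)).2.2.1⟩
  · exact ⟨1, fun x => (connForm_apply P.hermitian _ x (P.ne_zero x)).2.2.2⟩

theorem smooth_connForm (P : IsInvariantPair g V) {K : VField E M} (hK : K = V ∨ K = JField V)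
    {X : VField E M} (hX : IsSmoothField X) :
    ContMDiff 𝓘(ℝ, E) 𝓘(ℝ, ℝ) ∞ (fun y => connForm g K y (X y)) := by
  have h1 : ContMDiff 𝓘(ℝ, E) 𝓘(ℝ, ℝ) ∞ (fun y => (g.inner y (K y) (K y))⁻¹) := fun y =>
    ((P.smooth_of_mem hK).inner g (P.smooth_of_mem hK) y).inv₀ (by
      rw [P.inner_self hK]; exact (P.pos y).ne')
  exact h1.mul ((P.smooth_of_mem hK).inner g hX)

end IsInvariantPair

/-- `e` is a smooth vector field which is horizontal, i.e. orthogonal to `V` and `J V`. Zeros are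
allowed, so that there are globally defined fields which do not vanish at a given point. -/
structure IsHorizontal (g : Metric E M) (V e : VField E M) : Prop where
  smooth : IsSmoothField e
  inner_V : ∀ x, g.inner x (e x) (V x) = 0
  inner_JV : ∀ x, g.inner x (e x) (J x (V x)) = 0

/-- In a complex plane, `v ≠ 0` and a vector `e` outside the complex line of `v` form a basis; here
this is expressed by real coefficients. -/
theorem exists_real_combination (hE : Module.finrank ℂ E = 2) {v e : E} (hv : v ≠ 0)
    (he : ∀ a b : ℝ, e ≠ a • v + b • (Complex.I • v)) (u : E) :
    ∃ a b c d : ℝ, u = a • v + b • (Complex.I • v) + c • e + d • (Complex.I • e) := by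
  have hz : ∀ (z : ℂ) (w : E), z • w = z.re • w + z.im • (Complex.I • w) := by
    intro z w
    conv_lhs => rw [← Complex.re_add_im z, add_smul, mul_smul]
    simp only [Complex.coe_smul]
  have hli : LinearIndependent ℂ ![v, e] := by
    rw [LinearIndependent.pair_iff' hv]
    intro z h
    exact he z.re z.im (by rw [← hz, h])
  have : FiniteDimensional ℂ E := Module.finite_of_finrank_pos (by omega)
  have hs := hli.span_eq_top_of_card_eq_finrank (by simp [hE])
  have hu : u ∈ Submodule.span ℂ (Set.range ![v, e]) := hs ▸ Submodule.mem_top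
  simp only [Matrix.range_cons, Matrix.range_empty, Set.union_empty, Set.singleton_union] at hu
  obtain ⟨z, w, rfl⟩ := Submodule.mem_span_pair.1 hu
  exact ⟨z.re, z.im, w.re, w.im, by rw [hz z v, hz w e]; abel⟩

theorem exists_ne_real_combination (hE : Module.finrank ℂ E = 2) (v : E) :
    ∃ u : E, ∀ a b : ℝ, u ≠ a • v + b • (Complex.I • v) := by
  by_contra! h
  have hs : Submodule.span ℂ {v} = ⊤ := by
    refine eq_top_iff.2 fun u _ => ?_
    obtain ⟨a, b, rfl⟩ := h u
    refine Submodule.mem_span_singleton.2 ⟨a + b * Complex.I, ?_⟩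
    rw [add_smul, mul_smul]; simp only [Complex.coe_smul]
  have := finrank_span_le_card (R := ℂ) ({v} : Set E)
  rw [hs, finrank_top, hE] at this
  simp at this

namespace IsInvariantPair

variable {g : Metric E M} {V : VField E M}

/-- Expansion of a tangent vector in the orthogonal frame `V, J V, e, J e`, where `e` is
horizontal; the factor `g(e, e)` makes it valid also where `e` vanishes. -/
theorem expansion (P : IsInvariantPair g V) (hE : Module.finrank ℂ E = 2) {x : M}
    {e : TangentSpace 𝓘(ℝ, E) x} (h1 : g.inner x e (V x) = 0) (h2 : g.inner x e (J x (V x)) = 0)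
    (u : TangentSpace 𝓘(ℝ, E) x) :
    g.inner x e e • u = (g.inner x e e * connForm g V x u) • V x
      + (g.inner x e e * connForm g (JField V) x u) • J x (V x)
      + g.inner x u e • e + g.inner x u (J x e) • J x e := by
  by_cases he : e = 0
  · subst he; simp
  have hg := P.hermitian
  have hp := P.pos x
  have hpe := g.pos x e he
  have hne : ∀ a b : ℝ, e ≠ a • V x + b • J x (V x) := by
    intro a b h
    have : g.inner x e e = 0 := by
      have h3 := congrArg (g.inner x e) h
      rwa [map_add, map_smul, map_smul, h1, h2, smul_zero, smul_zero, add_zero] at h3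
    exact hpe.ne' this
  obtain ⟨a, b, c, d, hu⟩ : ∃ a b c d : ℝ,
      u = a • V x + b • J x (V x) + c • e + d • J x e :=
    exists_real_combination hE (P.ne_zero x) hne u
  have e1 : g.inner x (V x) e = 0 := by rw [g.symm, h1]
  have e2 : g.inner x (J x (V x)) e = 0 := by rw [g.symm, h2]
  have e3 : g.inner x (V x) (J x e) = 0 := by
    have := hg.inner_J_left x (V x) e; rw [e2] at this; linarith
  have e4 : g.inner x (J x (V x)) (J x e) = 0 := by rw [hg x, e1]
  have e5 := inner_J_self hg x e
  have e6 := inner_J_self hg x (V x)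
  have e7 := hg.inner_J_self_left x e
  have e8 := hg.inner_J_self_left x (V x)
  have k1 : connForm g V x u = a := by
    subst hu
    simp only [connForm, smul_apply, map_add, map_smul, smul_eq_mul, e6, e1, e3]
    field_simp; ring
  have k2 : connForm g (JField V) x u = b := by
    subst hu
    simp only [connForm, JField, smul_apply, map_add, map_smul, smul_eq_mul, hg x, e8, e2, e1]
    field_simp; ring
  have k3 : g.inner x u e = c * g.inner x e e := by
    subst hu
    simp only [add_apply, smul_apply, map_add, map_smul, smul_eq_mul, e1, e2, e7]; ring
  have k4 : g.inner x u (J x e) = d * g.inner x e e := by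
    subst hu
    simp only [add_apply, smul_apply, map_add, map_smul, smul_eq_mul, e3, e4, e5, hg x]; ring
  rw [k1, k2, k3, k4, hu]
  module

theorem exists_isHorizontal [FiniteDimensional ℂ E] [T2Space M] (P : IsInvariantPair g V)
    (hE : Module.finrank ℂ E = 2) (x : M) : ∃ e, IsHorizontal g V e ∧ e x ≠ 0 := by
  obtain ⟨u, hu⟩ := exists_ne_real_combination hE (show E from V x)
  obtain ⟨X, hX, rfl⟩ := exists_smoothField (M := M) (x := x) u
  have hs : IsSmoothField (fun y => hor g V (JField V) y (X y)) :=
    (hX.sub (IsSmoothField.smul (P.smooth_connForm (.inl rfl) hX) P.smooth)).sub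
      (IsSmoothField.smul (P.smooth_connForm (.inr rfl) hX) P.smooth.JField)
  refine ⟨_, ⟨hs, fun y => (hor_orthogonal P.hermitian V y (P.ne_zero y) _).1,
    fun y => (hor_orthogonal P.hermitian V y (P.ne_zero y) _).2⟩, fun h => ?_⟩
  refine hu (connForm g V x (X x)) (connForm g (JField V) x (X x)) ?_
  simp only [hor, sub_eq_zero] at h
  exact sub_eq_iff_eq_add'.1 h

end IsInvariantPair

end AdaptedFrame

noncomputable section Tensoriality

/-! ### Tensoriality of the exterior derivative of a `1`-form -/

variable {E : Type*} [NormedAddCommGroup E] [NormedSpace ℝ E]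
  {M : Type*} [TopologicalSpace M] [ChartedSpace E M]

theorem extDerivOne_swap (α : OneForm E M) (X Y : VField E M) (x : M) :
    extDerivOne α X Y x = -extDerivOne α Y X x := by
  simp only [extDerivOne, lieBr_swap X Y, map_neg]; ring

theorem extDerivOne_self (α : OneForm E M) (X : VField E M) (x : M) :
    extDerivOne α X X x = 0 := by
  have := extDerivOne_swap α X X x
  linarith

theorem extDerivOne_neg (α : OneForm E M) (X Y : VField E M) (x : M) :
    extDerivOne (fun y => -α y) X Y x = -extDerivOne α X Y x := by
  have h : ∀ (X : VField E M) (f : M → ℝ), dirDeriv X (fun y => -f y) x = -dirDeriv X f x := by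
    intro X f
    have := mvfderiv_neg (I := 𝓘(ℝ, E)) (g := f) (x := x)
    simp only [dirDeriv]
    change mvfderiv 𝓘(ℝ, E) (-f) x (X x) = _
    rw [this]; simp
  simp only [extDerivOne, neg_apply, h]; ring

variable [IsManifold 𝓘(ℝ, E) ∞ M]

/-- The function `T` of a smooth vector field is additive and `C^∞(M)`-linear at the point `x`. -/
structure IsTensorAt (x : M) (T : VField E M → ℝ) : Prop where
  add : ∀ {X Y : VField E M}, IsSmoothField X → IsSmoothField Y → T (X + Y) = T X + T Y
  smul : ∀ {f : M → ℝ} {X : VField E M}, ContMDiff 𝓘(ℝ, E) 𝓘(ℝ, ℝ) ∞ f → IsSmoothField X →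
    T (f • X) = f x * T X

theorem smooth_extDerivOne [CompleteSpace E] {α : OneForm E M}
    (hα : ∀ X, IsSmoothField X → ContMDiff 𝓘(ℝ, E) 𝓘(ℝ, ℝ) ∞ fun y => α y (X y))
    {X Y : VField E M} (hX : IsSmoothField X) (hY : IsSmoothField Y) :
    ContMDiff 𝓘(ℝ, E) 𝓘(ℝ, ℝ) ∞ (extDerivOne α X Y) :=
  ((hX.dirDeriv (hα Y hY)).sub (hY.dirDeriv (hα X hX))).sub (hα _ (hX.lieBr hY))

theorem isTensorAt_extDerivOne [CompleteSpace E] {α : OneForm E M}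
    (hα : ∀ X, IsSmoothField X → ContMDiff 𝓘(ℝ, E) 𝓘(ℝ, ℝ) ∞ fun y => α y (X y))
    (Y : VField E M) (x : M) : IsTensorAt x (fun X => extDerivOne α X Y x) where
  add {X X'} hX hX' := by
    have h1 : lieBr (X + X') Y x = lieBr X Y x + lieBr X' Y x :=
      mlieBracket_add_left (hX.diff x) (hX'.diff x)
    have h2 := dirDeriv_add Y (smooth_diff (hα X hX) x) (smooth_diff (hα X' hX') x)
    simp only [extDerivOne, dirDeriv_add_left, Pi.add_apply, map_add, h1, h2]
    ring
  smul {f X} hf hX := by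
    have h2 := dirDeriv_mul Y (smooth_diff hf x) (smooth_diff (hα X hX) x)
    simp only [extDerivOne, dirDeriv_smul_left, lieBr_smul_left (smooth_diff hf x) (hX.diff x),
      Pi.smul_apply', map_add, map_neg, map_smul, smul_eq_mul, h2]
    ring

end Tensoriality

noncomputable section HorizontalForm

/-! ### The horizontal form `ω̌` -/

variable {E : Type*} [NormedAddCommGroup E] [NormedSpace ℂ E]
  {M : Type*} [TopologicalSpace M] [ChartedSpace E M] [IsManifold 𝓘(ℂ, E) ω M]
  {g : Metric E M} {V e : VField E M}

theorem fundForm_swap (hg : IsHermitianMetric g) (x : M) (u v : TangentSpace 𝓘(ℝ, E) x) :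
    fundForm g x u v = -fundForm g x v u := by
  simp only [fundForm]
  rw [hg.inner_J_left, g.symm x u]

/-- `ω̌ = ω - λ μ₁ ∧ μ₂`. -/
theorem IsInvariantPair.horForm_eq (P : IsInvariantPair g V) (x : M)
    (u v : TangentSpace 𝓘(ℝ, E) x) :
    horForm g V (JField V) x u v = fundForm g x u v - g.inner x (V x) (V x) *
      (connForm g V x u * connForm g (JField V) x v
        - connForm g V x v * connForm g (JField V) x u) := by
  have hg := P.hermitian
  have hp := (P.pos x).ne'
  have e5 := inner_J_self hg x (V x)
  have e6 := hg.inner_J_self_left x (V x)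
  have h1 : g.inner x u (V x) = g.inner x (V x) u := g.symm _ _ _
  have h3 : g.inner x (J x u) (V x) = -g.inner x (J x (V x)) u := by
    rw [hg.inner_J_left, g.symm]
  simp only [horForm, hor, connForm, fundForm, JField, map_sub, map_smul, sub_apply, smul_apply,
    smul_eq_mul, hg x, J_J, map_neg, neg_apply, e5, e6, h1, h3]
  field_simp
  ring

/-- In terms of a horizontal vector `e`, the form `ω̌` is `|e|⁻² g(e, ·) ∧ g(J e, ·)`. -/
theorem IsInvariantPair.inner_mul_horForm (P : IsInvariantPair g V)
    (hE : Module.finrank ℂ E = 2) (he : IsHorizontal g V e) (x : M)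
    (u v : TangentSpace 𝓘(ℝ, E) x) :
    g.inner x (e x) (e x) * horForm g V (JField V) x u v =
      g.inner x u (e x) * g.inner x v (J x (e x)) - g.inner x u (J x (e x)) * g.inner x v (e x) := by
  by_cases h0 : e x = 0
  · simp [h0]
  have hne := (g.pos x _ h0).ne'
  have hh : ∀ u, g.inner x (e x) (e x) • hor g V (JField V) x u =
      g.inner x u (e x) • e x + g.inner x u (J x (e x)) • J x (e x) := by
    intro u
    simp only [hor, smul_sub, P.expansion hE (he.inner_V x) (he.inner_JV x) u, JField, mul_smul]
    abel
  have key : g.inner x (J x (g.inner x (e x) (e x) • hor g V (JField V) x u))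
      (g.inner x (e x) (e x) • hor g V (JField V) x v) =
      g.inner x (e x) (e x) * (g.inner x u (e x) * g.inner x v (J x (e x))
        - g.inner x u (J x (e x)) * g.inner x v (e x)) := by
    rw [hh u, hh v]
    simp only [map_add, map_smul, add_apply, smul_apply, smul_eq_mul, J_J, map_neg, neg_apply,
      P.hermitian x, inner_J_self P.hermitian, P.hermitian.inner_J_self_left]
    ring
  simp only [map_smul, smul_apply, smul_eq_mul] at key
  exact mul_left_cancel₀ hne key

theorem IsInvariantPair.horForm_frame_right (P : IsInvariantPair g V)
    (hE : Module.finrank ℂ E = 2) (he : IsHorizontal g V e) {x : M} (hx : e x ≠ 0)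
    (u : TangentSpace 𝓘(ℝ, E) x) :
    horForm g V (JField V) x u (J x (e x)) = g.inner x u (e x) := by
  have h := P.inner_mul_horForm hE he x u (J x (e x))
  rw [P.hermitian x, P.hermitian.inner_J_self_left, mul_zero, sub_zero, mul_comm] at h
  exact mul_right_cancel₀ (g.pos x _ hx).ne' h

theorem IsInvariantPair.horForm_frame_left (P : IsInvariantPair g V)
    (hE : Module.finrank ℂ E = 2) (he : IsHorizontal g V e) {x : M} (hx : e x ≠ 0)
    (u : TangentSpace 𝓘(ℝ, E) x) :
    horForm g V (JField V) x (e x) (J x u) = g.inner x u (e x) := by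
  have h := P.inner_mul_horForm hE he x (e x) (J x u)
  rw [P.hermitian x, inner_J_self P.hermitian, zero_mul, sub_zero] at h
  exact mul_left_cancel₀ (g.pos x _ hx).ne' h

theorem IsHorizontal.smooth_J (he : IsHorizontal g V e) : IsSmoothField (JField e) :=
  he.smooth.JField

theorem IsHorizontal.smooth_normSq (he : IsHorizontal g V e) :
    ContMDiff 𝓘(ℝ, E) 𝓘(ℝ, ℝ) ∞ (fun y => g.inner y (e y) (e y)) := he.smooth.inner g he.smooth

/-- A tensorial expression is determined by its values on the frame `V, J V, e, J e`. -/
theorem IsTensorAt.expand {x : M} {T : VField E M → ℝ} (hT : IsTensorAt x T)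
    (P : IsInvariantPair g V) (hE : Module.finrank ℂ E = 2) (he : IsHorizontal g V e)
    {Z : VField E M} (hZ : IsSmoothField Z) :
    g.inner x (e x) (e x) * T Z =
      g.inner x (e x) (e x) * connForm g V x (Z x) * T V
        + g.inner x (e x) (e x) * connForm g (JField V) x (Z x) * T (JField V)
        + g.inner x (Z x) (e x) * T e + g.inner x (Z x) (J x (e x)) * T (JField e) := by
  let f₁ : M → ℝ := fun y => g.inner y (e y) (e y) * connForm g V y (Z y)
  let f₂ : M → ℝ := fun y => g.inner y (e y) (e y) * connForm g (JField V) y (Z y)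
  let f₃ : M → ℝ := fun y => g.inner y (Z y) (e y)
  let f₄ : M → ℝ := fun y => g.inner y (Z y) (JField e y)
  have h1 : ContMDiff 𝓘(ℝ, E) 𝓘(ℝ, ℝ) ∞ f₁ := he.smooth_normSq.mul (P.smooth_connForm (.inl rfl) hZ)
  have h2 : ContMDiff 𝓘(ℝ, E) 𝓘(ℝ, ℝ) ∞ f₂ := he.smooth_normSq.mul (P.smooth_connForm (.inr rfl) hZ)
  have h3 : ContMDiff 𝓘(ℝ, E) 𝓘(ℝ, ℝ) ∞ f₃ := hZ.inner g he.smooth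
  have h4 : ContMDiff 𝓘(ℝ, E) 𝓘(ℝ, ℝ) ∞ f₄ := hZ.inner g he.smooth_J
  have h : (fun y => g.inner y (e y) (e y)) • Z = f₁ • V + f₂ • JField V + f₃ • e + f₄ • JField e :=
    funext fun y => P.expansion hE (he.inner_V y) (he.inner_JV y) (Z y)
  have s1 := IsSmoothField.smul h1 P.smooth
  have s2 := IsSmoothField.smul h2 P.smooth.JField
  have s3 := IsSmoothField.smul h3 he.smooth
  have s4 := IsSmoothField.smul h4 he.smooth_J
  have := congrArg T h
  rwa [hT.smul he.smooth_normSq hZ, hT.add ((s1.add s2).add s3) s4, hT.add (s1.add s2) s3,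
    hT.add s1 s2, hT.smul h1 P.smooth, hT.smul h2 P.smooth.JField, hT.smul h3 he.smooth,
    hT.smul h4 he.smooth_J] at this

end HorizontalForm

noncomputable section Curvature

/-! ### The curvature functions `σ₁`, `σ₂` -/

variable {E : Type*} [NormedAddCommGroup E] [NormedSpace ℂ E]
  {M : Type*} [TopologicalSpace M] [ChartedSpace E M] [IsManifold 𝓘(ℂ, E) ω M]
  {g : Metric E M} {V K Z : VField E M}

namespace IsInvariantPair

theorem dirDeriv_inner (P : IsInvariantPair g V) (hZ : Z = V ∨ Z = JField V)
    (hK : K = V ∨ K = JField V) {Y : VField E M} (hY : IsSmoothField Y) (x : M) :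
    dirDeriv Z (fun y => g.inner y (K y) (Y y)) x = g.inner x (K x) (lieBr Z Y x) := by
  rw [P.killing Z hZ K Y (P.smooth_of_mem hK) hY, P.lieBr_eq_zero hZ hK]
  simp

/-- The length of `V` is invariant. -/
theorem dirDeriv_normSq (P : IsInvariantPair g V) (hZ : Z = V ∨ Z = JField V) (x : M) :
    dirDeriv Z (fun y => g.inner y (V y) (V y)) x = 0 := by
  rw [P.dirDeriv_inner hZ (.inl rfl) P.smooth, P.lieBr_eq_zero hZ (.inl rfl)]
  simp

theorem inner_eq_mul_connForm (P : IsInvariantPair g V) (hK : K = V ∨ K = JField V) (x : M)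
    (u : TangentSpace 𝓘(ℝ, E) x) :
    g.inner x (K x) u = g.inner x (V x) (V x) * connForm g K x u := by
  have := (P.pos x).ne'
  simp only [connForm, P.inner_self hK, smul_apply, smul_eq_mul]
  field_simp

theorem smooth_normSq (P : IsInvariantPair g V) :
    ContMDiff 𝓘(ℝ, E) 𝓘(ℝ, ℝ) ∞ (fun y => g.inner y (V y) (V y)) := P.smooth.inner g P.smooth

/-- `𝓛_Z μ = 0`. -/
theorem dirDeriv_connForm (P : IsInvariantPair g V) (hZ : Z = V ∨ Z = JField V)
    (hK : K = V ∨ K = JField V) {Y : VField E M} (hY : IsSmoothField Y) (x : M) :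
    dirDeriv Z (fun y => connForm g K y (Y y)) x = connForm g K x (lieBr Z Y x) := by
  have h := P.dirDeriv_inner hZ hK hY x
  simp only [P.inner_eq_mul_connForm hK] at h
  rw [dirDeriv_mul Z (smooth_diff P.smooth_normSq x) (smooth_diff (P.smooth_connForm hK hY) x),
    P.dirDeriv_normSq hZ, zero_mul, zero_add] at h
  exact mul_left_cancel₀ (P.pos x).ne' h

/-- `dμ` is horizontal. -/
theorem extDerivOne_connForm_vertical (P : IsInvariantPair g V) (hZ : Z = V ∨ Z = JField V)
    (hK : K = V ∨ K = JField V) {Y : VField E M} (hY : IsSmoothField Y) (x : M) :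
    extDerivOne (connForm g K) Z Y x = 0 := by
  obtain ⟨c, hc⟩ := P.connForm_const hK hZ
  simp only [extDerivOne, hc, dirDeriv_const, P.dirDeriv_connForm hZ hK hY]
  ring

variable [FiniteDimensional ℂ E]

/-- `𝓛_Z dμ = 0`. -/
theorem dirDeriv_extDerivOne_connForm (P : IsInvariantPair g V) (hZ : Z = V ∨ Z = JField V)
    (hK : K = V ∨ K = JField V) {X Y : VField E M} (hX : IsSmoothField X) (hY : IsSmoothField Y)
    (x : M) :
    dirDeriv Z (extDerivOne (connForm g K) X Y) x =
      extDerivOne (connForm g K) (lieBr Z X) Y x + extDerivOne (connForm g K) X (lieBr Z Y) x := by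
  have hc : CompleteSpace E := FiniteDimensional.complete ℂ E
  have hZs := P.smooth_of_mem hZ
  have sX := P.smooth_connForm hK hX
  have sY := P.smooth_connForm hK hY
  have fX : dirDeriv Z (fun y => connForm g K y (X y)) = fun y => connForm g K y (lieBr Z X y) :=
    funext (P.dirDeriv_connForm hZ hK hX)
  have fY : dirDeriv Z (fun y => connForm g K y (Y y)) = fun y => connForm g K y (lieBr Z Y y) :=
    funext (P.dirDeriv_connForm hZ hK hY)
  have c1 := dirDeriv_lieBr hZs hX P.smooth sY (P.ne_zero x)
  have c2 := dirDeriv_lieBr hZs hY P.smooth sX (P.ne_zero x)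
  rw [fY] at c1
  rw [fX] at c2
  have h1 := dirDeriv_sub Z (smooth_diff ((hX.dirDeriv sY).sub (hY.dirDeriv sX)) x)
    (smooth_diff (P.smooth_connForm hK (hX.lieBr hY)) x)
  have h2 := dirDeriv_sub Z (smooth_diff (hX.dirDeriv sY) x) (smooth_diff (hY.dirDeriv sX) x)
  have h3 := P.dirDeriv_connForm hZ hK (hX.lieBr hY) x
  rw [jacobi hZs hX hY, map_add] at h3
  change dirDeriv Z (fun y => (dirDeriv X (fun z => connForm g K z (Y z)) y
    - dirDeriv Y (fun z => connForm g K z (X z)) y) - connForm g K y (lieBr X Y y)) x = _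
  simp only [extDerivOne]
  linarith

/-- The differential of a connection form is a multiple of `ω̌`, by tensoriality and because it
vanishes on vertical vectors. -/
theorem extDerivOne_connForm_eq (P : IsInvariantPair g V) (hE : Module.finrank ℂ E = 2)
    (hK : K = V ∨ K = JField V) {e : VField E M} (he : IsHorizontal g V e) {X Y : VField E M}
    (hX : IsSmoothField X) (hY : IsSmoothField Y) {x : M} (hx : e x ≠ 0) :
    extDerivOne (connForm g K) X Y x =
      extDerivOne (connForm g K) e (JField e) x / g.inner x (e x) (e x)
        * horForm g V (JField V) x (X x) (Y x) := by
  have hc : CompleteSpace E := FiniteDimensional.complete ℂ E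
  have hp := (g.pos x _ hx).ne'
  have hα := fun X (hX : IsSmoothField X) => P.smooth_connForm hK hX
  have h1 := (isTensorAt_extDerivOne hα Y x).expand P hE he hX
  have h2 := (isTensorAt_extDerivOne hα e x).expand P hE he hY
  have h3 := (isTensorAt_extDerivOne hα (JField e) x).expand P hE he hY
  simp only [P.extDerivOne_connForm_vertical (.inl rfl) hK hY,
    P.extDerivOne_connForm_vertical (.inr rfl) hK hY,
    extDerivOne_swap _ e Y, extDerivOne_swap _ (JField e) Y] at h1
  simp only [P.extDerivOne_connForm_vertical (.inl rfl) hK he.smooth,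
    P.extDerivOne_connForm_vertical (.inr rfl) hK he.smooth, extDerivOne_self,
    extDerivOne_swap _ (JField e) e] at h2
  simp only [P.extDerivOne_connForm_vertical (.inl rfl) hK he.smooth_J,
    P.extDerivOne_connForm_vertical (.inr rfl) hK he.smooth_J, extDerivOne_self] at h3
  have h4 := P.inner_mul_horForm hE he x (X x) (Y x)
  have h5 : g.inner x (e x) (e x) * (g.inner x (e x) (e x) * extDerivOne (connForm g K) X Y x) =
      g.inner x (e x) (e x) * (extDerivOne (connForm g K) e (JField e) x *
        horForm g V (JField V) x (X x) (Y x)) := by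
    rw [h1]
    linear_combination (-g.inner x (X x) (e x)) * h2 - g.inner x (X x) (J x (e x)) * h3
      - extDerivOne (connForm g K) e (JField e) x * h4
  have h6 := mul_left_cancel₀ hp h5
  field_simp
  linarith

/-- The structure functions: `dμ = σ ω̌` for a unique function `σ`, which is smooth. Locally
`σ = dμ(e, J e) / g(e, e)` for any horizontal field `e` without zeros. -/
theorem exists_curvature [T2Space M] (P : IsInvariantPair g V) (hE : Module.finrank ℂ E = 2)
    (hK : K = V ∨ K = JField V) :
    ∃ σ : M → ℝ, ContMDiff 𝓘(ℝ, E) 𝓘(ℝ, ℝ) ∞ σ ∧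
      ∀ τ : M → ℝ, ExtDerivEq (connForm g K) τ (horForm g V (JField V)) ↔ τ = σ := by
  have hc : CompleteSpace E := FiniteDimensional.complete ℂ E
  choose e he hex using P.exists_isHorizontal hE
  let σ : M → ℝ := fun x =>
    extDerivOne (connForm g K) (e x) (JField (e x)) x / g.inner x (e x x) (e x x)
  have hσ : ExtDerivEq (connForm g K) σ (horForm g V (JField V)) := fun X Y hX hY x =>
    P.extDerivOne_connForm_eq hE hK (he x) hX hY (hex x)
  have hu : ∀ τ : M → ℝ, ExtDerivEq (connForm g K) τ (horForm g V (JField V)) →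
      ∀ e' x, IsHorizontal g V e' → e' x ≠ 0 → τ x =
        extDerivOne (connForm g K) e' (JField e') x / g.inner x (e' x) (e' x) := by
    intro τ hτ e' x he' hx
    rw [hτ _ _ he'.smooth he'.smooth_J x]
    change _ = τ x * horForm g V (JField V) x (e' x) (J x (e' x)) / _
    rw [P.horForm_frame_right hE he' hx, mul_div_assoc, div_self (g.pos x _ hx).ne', mul_one]
  refine ⟨σ, fun x₀ => ?_, fun τ => ⟨fun hτ => funext fun x => ?_, fun h => h ▸ hσ⟩⟩
  · have h1 := smooth_extDerivOne (fun X hX => P.smooth_connForm hK hX) (he x₀).smooth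
      (he x₀).smooth_J
    have h2 := (he x₀).smooth_normSq
    have h0 := (g.pos x₀ _ (hex x₀)).ne'
    refine ((h1 x₀).div₀ (h2 x₀) h0).congr_of_eventuallyEq ?_
    filter_upwards [(h2 x₀).continuousAt.eventually_ne h0] with x hx
    refine hu σ hσ (e x₀) x (he x₀) fun h => hx ?_
    simp [h]
  · exact hu τ hτ (e x) x (he x) (hex x)

/-- `σ` is invariant, because `dμ`, `g` and `J` are: apply `𝓛_Z` to `dμ(e, J e) = σ g(e, e)`. -/
theorem dirDeriv_curvature [T2Space M] (P : IsInvariantPair g V) (hE : Module.finrank ℂ E = 2)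
    (hZ : Z = V ∨ Z = JField V) (hK : K = V ∨ K = JField V) {σ : M → ℝ}
    (hs : ContMDiff 𝓘(ℝ, E) 𝓘(ℝ, ℝ) ∞ σ)
    (hσ : ExtDerivEq (connForm g K) σ (horForm g V (JField V))) (x : M) :
    dirDeriv Z σ x = 0 := by
  have hc : CompleteSpace E := FiniteDimensional.complete ℂ E
  obtain ⟨e, he, hx⟩ := P.exists_isHorizontal hE x
  have hZs := P.smooth_of_mem hZ
  have h1 := P.dirDeriv_extDerivOne_connForm hZ hK he.smooth he.smooth_J x
  have h2 : extDerivOne (connForm g K) e (JField e) = fun y => σ y * g.inner y (e y) (e y) := by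
    funext y
    rw [hσ _ _ he.smooth he.smooth_J y]
    by_cases hy : e y = 0
    · simp [hy, horForm, hor, fundForm, JField]
    · exact congrArg _ (P.horForm_frame_right hE he hy _)
  rw [h2, dirDeriv_mul Z (smooth_diff hs x) (smooth_diff he.smooth_normSq x),
    hσ _ _ (hZs.lieBr he.smooth) he.smooth_J x, P.holomorphic Z hZ e he.smooth,
    hσ _ _ he.smooth (hZs.lieBr he.smooth).JField x, P.killing Z hZ e e he.smooth he.smooth] at h1
  have h3 := P.horForm_frame_right hE he hx (lieBr Z e x)
  have h4 := P.horForm_frame_left hE he hx (lieBr Z e x)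
  simp only [JField, h3] at h1
  rw [h4, g.symm x (e x) (lieBr Z e x)] at h1
  have h5 : dirDeriv Z σ x * g.inner x (e x) (e x) = 0 := by linarith
  exact (mul_eq_zero.1 h5).resolve_right (g.pos x _ hx).ne'

end IsInvariantPair

end Curvature

noncomputable section FundamentalForm

/-! ### The differential of `ω` and the Koszul expression -/

variable {E : Type*} [NormedAddCommGroup E] [NormedSpace ℂ E]
  {M : Type*} [TopologicalSpace M] [ChartedSpace E M] [IsManifold 𝓘(ℂ, E) ω M]
  {g : Metric E M} {V K L Z : VField E M}

theorem wedgeOneTwo_swap_left (hg : IsHermitianMetric g)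
    (θ : OneForm E M) (X Y Z : VField E M) (x : M) :
    wedgeOneTwo θ (fundForm g) X Y Z x = -wedgeOneTwo θ (fundForm g) Y X Z x := by
  simp only [wedgeOneTwo, fundForm_swap hg x (X x) (Y x)]; ring

theorem wedgeOneTwo_swap_right (hg : IsHermitianMetric g)
    (θ : OneForm E M) (X Y Z : VField E M) (x : M) :
    wedgeOneTwo θ (fundForm g) X Y Z x = -wedgeOneTwo θ (fundForm g) X Z Y x := by
  simp only [wedgeOneTwo, fundForm_swap hg x (Y x) (Z x)]; ring

theorem dirDeriv_fundForm_swap (hg : IsHermitianMetric g)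
    (X Y Z : VField E M) (x : M) :
    dirDeriv X (fun y => fundForm g y (Y y) (Z y)) x =
      -dirDeriv X (fun y => fundForm g y (Z y) (Y y)) x := by
  have := mvfderiv_neg (I := 𝓘(ℝ, E)) (g := fun y => fundForm g y (Z y) (Y y)) (x := x)
  simp only [dirDeriv]
  rw [show (fun y => fundForm g y (Y y) (Z y)) = -fun y => fundForm g y (Z y) (Y y) from
    funext fun y => fundForm_swap hg y _ _, this]
  simp

theorem extDerivTwo_swap_left (hg : IsHermitianMetric g)
    (X Y Z : VField E M) (x : M) :
    extDerivTwo (fundForm g) X Y Z x = -extDerivTwo (fundForm g) Y X Z x := by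
  have h : ∀ u v : TangentSpace 𝓘(ℝ, E) x, fundForm g x (-u) v = -fundForm g x u v := by
    intro u v; simp [fundForm]
  simp only [extDerivTwo, dirDeriv_fundForm_swap hg Z X Y, lieBr_swap X Y, h]; ring

theorem extDerivTwo_swap_right (hg : IsHermitianMetric g)
    (X Y Z : VField E M) (x : M) :
    extDerivTwo (fundForm g) X Y Z x = -extDerivTwo (fundForm g) X Z Y x := by
  have h : ∀ u v : TangentSpace 𝓘(ℝ, E) x, fundForm g x (-u) v = -fundForm g x u v := by
    intro u v; simp [fundForm]
  simp only [extDerivTwo, dirDeriv_fundForm_swap hg X Y Z, lieBr_swap Y Z, h]; ring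

theorem IsSmoothField.fundForm (g : Metric E M) {X Y : VField E M} (hX : IsSmoothField X)
    (hY : IsSmoothField Y) :
    ContMDiff 𝓘(ℝ, E) 𝓘(ℝ, ℝ) ∞ (fun y => fundForm g y (X y) (Y y)) := hX.JField.inner g hY

/-- `dω - θ ∧ ω` is `C^∞(M)`-linear in its last argument. -/
theorem isTensorAt_extDerivTwo [CompleteSpace E] (hg : IsHermitianMetric g) (θ : OneForm E M)
    {X Y : VField E M} (hX : IsSmoothField X) (hY : IsSmoothField Y) (x : M) :
    IsTensorAt x (fun Z => extDerivTwo (fundForm g) X Y Z x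
      - wedgeOneTwo θ (fundForm g) X Y Z x) where
  add {Z Z'} hZ hZ' := by
    have l : ∀ u v w : TangentSpace 𝓘(ℝ, E) x,
        fundForm g x u (v + w) = fundForm g x u v + fundForm g x u w := by
      intro u v w; simp [fundForm]
    have l' : ∀ u v w : TangentSpace 𝓘(ℝ, E) x,
        fundForm g x (u + v) w = fundForm g x u w + fundForm g x v w := by
      intro u v w; simp [fundForm]
    have a : ∀ {A B : VField E M}, IsSmoothField A →
        dirDeriv B (fun y => fundForm g y (A y) (Z y + Z' y)) x =
          dirDeriv B (fun y => fundForm g y (A y) (Z y)) x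
            + dirDeriv B (fun y => fundForm g y (A y) (Z' y)) x := by
      intro A B hA
      rw [← dirDeriv_add B (smooth_diff (hA.fundForm g hZ) x) (smooth_diff (hA.fundForm g hZ') x)]
      congr 1
      funext y
      simp [fundForm]
    have h3 : lieBr X (Z + Z') x = lieBr X Z x + lieBr X Z' x :=
      mlieBracket_add_right (hZ.diff x) (hZ'.diff x)
    have h4 : lieBr Y (Z + Z') x = lieBr Y Z x + lieBr Y Z' x :=
      mlieBracket_add_right (hZ.diff x) (hZ'.diff x)
    simp only [extDerivTwo, wedgeOneTwo, dirDeriv_add_left, a hX, a hY, h3, h4, l, l',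
      Pi.add_apply, map_add]
    ring
  smul {f Z} hf hZ := by
    have l : ∀ (c : ℝ) (u v : TangentSpace 𝓘(ℝ, E) x),
        fundForm g x u (c • v) = c * fundForm g x u v := by
      intro c u v; simp [fundForm]
    have l' : ∀ (c d : ℝ) (u v w : TangentSpace 𝓘(ℝ, E) x),
        fundForm g x (c • u + d • v) w = c * fundForm g x u w + d * fundForm g x v w := by
      intro c d u v w; simp [fundForm]
    have a : ∀ {A B : VField E M}, IsSmoothField A →
        dirDeriv B (fun y => fundForm g y (A y) (f y • Z y)) x =
          dirDeriv B f x * fundForm g x (A x) (Z x)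
            + f x * dirDeriv B (fun y => fundForm g y (A y) (Z y)) x := by
      intro A B hA
      rw [← dirDeriv_mul B (smooth_diff hf x) (smooth_diff (hA.fundForm g hZ) x)]
      congr 1
      funext y
      simp [fundForm]
    simp only [extDerivTwo, wedgeOneTwo, dirDeriv_smul_left, a hX, a hY,
      lieBr_smul_right (smooth_diff hf x) (hZ.diff x), l, l', Pi.smul_apply', map_smul,
      smul_eq_mul, fundForm_swap hg x (Z x)]
    ring

namespace IsInvariantPair

/-- Cartan's formula `ι_Z dω = -d(ι_Z ω)`, as `𝓛_Z ω = 0`. -/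
theorem extDerivTwo_vertical (P : IsInvariantPair g V) (hZ : Z = V ∨ Z = JField V)
    {X Y : VField E M} (hX : IsSmoothField X) (hY : IsSmoothField Y) (x : M) :
    extDerivTwo (fundForm g) Z X Y x =
      -extDerivOne (fun y => g.inner y (J y (Z y))) X Y x := by
  have hg := P.hermitian
  have h1 := P.killing Z hZ _ Y hX.JField hY x
  rw [P.holomorphic Z hZ X hX] at h1
  have h2 := hg.inner_J_left x (lieBr Z Y x) (X x)
  have h3 := hg.inner_J_left x (lieBr X Y x) (Z x)
  rw [g.symm] at h3
  have h4 := g.symm x (lieBr Z Y x) (J x (X x))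
  have h5 := g.symm x (lieBr X Y x) (J x (Z x))
  simp only [JField] at h1
  simp only [extDerivTwo, extDerivOne, fundForm]
  rw [g.symm x (J x (lieBr X Y x))]
  linarith

/-- `d(λ μ) = dλ ∧ μ + λ dμ`. -/
theorem extDerivOne_inner (P : IsInvariantPair g V) (hK : K = V ∨ K = JField V)
    {X Y : VField E M} (hX : IsSmoothField X) (hY : IsSmoothField Y) (x : M) :
    extDerivOne (fun y => g.inner y (K y)) X Y x =
      dirDeriv X (fun y => g.inner y (V y) (V y)) x * connForm g K x (Y x)
        - dirDeriv Y (fun y => g.inner y (V y) (V y)) x * connForm g K x (X x)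
        + g.inner x (V x) (V x) * extDerivOne (connForm g K) X Y x := by
  simp only [extDerivOne, P.inner_eq_mul_connForm hK]
  rw [dirDeriv_mul X (smooth_diff P.smooth_normSq x) (smooth_diff (P.smooth_connForm hK hY) x),
    dirDeriv_mul Y (smooth_diff P.smooth_normSq x) (smooth_diff (P.smooth_connForm hK hX) x)]
  ring

theorem extDerivOne_inner_of_const (P : IsInvariantPair g V) (hK : K = V ∨ K = JField V) {c s : ℝ}
    (hc : ∀ x, g.inner x (V x) (V x) = c)
    (hs : ExtDerivEq (connForm g K) (fun _ => s) (horForm g V (JField V))) {X Y : VField E M}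
    (hX : IsSmoothField X) (hY : IsSmoothField Y) (x : M) :
    extDerivOne (fun y => g.inner y (K y)) X Y x =
      c * s * horForm g V (JField V) x (X x) (Y x) := by
  rw [P.extDerivOne_inner hK hX hY, hs _ _ hX hY]
  simp only [hc, dirDeriv_const]
  ring

theorem extDerivTwo_V (P : IsInvariantPair g V) {X Y : VField E M} (hX : IsSmoothField X)
    (hY : IsSmoothField Y) (x : M) :
    extDerivTwo (fundForm g) V X Y x =
      -extDerivOne (fun y => g.inner y (JField V y)) X Y x :=
  P.extDerivTwo_vertical (.inl rfl) hX hY x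

theorem extDerivTwo_JV (P : IsInvariantPair g V) {X Y : VField E M} (hX : IsSmoothField X)
    (hY : IsSmoothField Y) (x : M) :
    extDerivTwo (fundForm g) (JField V) X Y x = extDerivOne (fun y => g.inner y (V y)) X Y x := by
  rw [P.extDerivTwo_vertical (.inr rfl) hX hY x]
  simp only [JField, J_J, map_neg]
  rw [extDerivOne_neg, neg_neg]

/-- `dλ = λ θ - θ(V) g(V, ·) - θ(J V) g(J V, ·)`, from `dω(V, J V, ·) = dλ`. -/
theorem dirDeriv_normSq_eq (P : IsInvariantPair g V) {θ : OneForm E M} (hθ : IsLeeForm g θ) {X : VField E M}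
    (hX : IsSmoothField X) (x : M) :
    dirDeriv X (fun y => g.inner y (V y) (V y)) x = g.inner x (V x) (V x) * θ x (X x)
      - θ x (V x) * g.inner x (V x) (X x) - θ x (J x (V x)) * g.inner x (J x (V x)) (X x) := by
  have h1 := hθ.2 _ _ _ P.smooth P.smooth.JField hX x
  rw [P.extDerivTwo_V P.smooth.JField hX, P.extDerivOne_inner (.inr rfl) P.smooth.JField hX,
    P.dirDeriv_normSq (.inr rfl), P.extDerivOne_connForm_vertical (.inr rfl) (.inr rfl) hX] at h1
  have h2 := (connForm_apply P.hermitian V x (P.ne_zero x)).2.2.2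
  simp only [wedgeOneTwo, fundForm, J_J, map_neg, neg_apply, JField, P.hermitian x] at h1 h2
  rw [h2] at h1
  linarith

/-- For a Killing field `K` the Koszul identity reads `2 g(∇_X Y, K) = 2 X(g(K, Y)) - dα(X, Y)`
with `α = g(K, ·)`. -/
theorem koszul_vertical_right (P : IsInvariantPair g V) (hK : K = V ∨ K = JField V)
    {X Y : VField E M} (hX : IsSmoothField X) (hY : IsSmoothField Y) (x : M) :
    koszul g X Y K x = 2 * dirDeriv X (fun y => g.inner y (K y) (Y y)) x
      - extDerivOne (fun y => g.inner y (K y)) X Y x := by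
  have h1 := P.killing K hK X Y hX hY x
  simp only [koszul, extDerivOne, lieBr_swap X K, lieBr_swap Y K, map_neg, neg_apply, h1,
    fun y => g.symm y (Y y) (K y), fun y => g.symm y (X y) (K y), g.symm x (lieBr X Y x),
    g.symm x (X x) (lieBr K Y x)]
  ring

/-- The Koszul expression of `∇_V V = -½ grad λ`. -/
theorem koszul_V_V (P : IsInvariantPair g V) {Z : VField E M} (hZ : IsSmoothField Z) (x : M) :
    koszul g V V Z x = -dirDeriv Z (fun y => g.inner y (V y) (V y)) x := by
  have h1 := P.dirDeriv_inner (.inl rfl) (.inl rfl) hZ x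
  simp only [koszul, h1, lieBr_self, Pi.zero_apply, map_zero, zero_apply,
    g.symm x (lieBr V Z x) (V x)]
  ring

/-- In particular `g(∇_X K, L) = 0` if `g(K, L)` is constant. -/
theorem koszul_vertical_vertical (P : IsInvariantPair g V) (hK : K = V ∨ K = JField V)
    (hL : L = V ∨ L = JField V) {X : VField E M} (hX : IsSmoothField X) (x : M) :
    koszul g X K L x = dirDeriv X (fun y => g.inner y (K y) (L y)) x := by
  have h1 := P.dirDeriv_inner hK hL hX x
  have h2 := P.dirDeriv_inner hL hK hX x
  simp only [koszul, P.lieBr_eq_zero hK hL, lieBr_swap X K, lieBr_swap X L, Pi.zero_apply,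
    map_zero, zero_apply, map_neg, neg_apply, fun y => g.symm y (X y) (K y),
    fun y => g.symm y (X y) (L y), h1, h2, g.symm x (lieBr K X x) (L x),
    g.symm x (lieBr L X x) (K x)]
  ring

end IsInvariantPair

theorem IsVerticalAlgebra.isInvariantPair {𝔱 : Submodule ℝ (VField E M)}
    (h𝔱 : IsVerticalAlgebra 𝔱) (hg : IsHermitianMetric g) (hinv : IsInvariantMetric 𝔱 g)
    (hV : V ∈ 𝔱) (h0 : V ≠ 0) : IsInvariantPair g V where
  hermitian := hg
  smooth := h𝔱.smooth V hV
  ne_zero x hx := h0 (h𝔱.free V hV x hx)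
  lieBr_J := h𝔱.abelian V hV _ (h𝔱.J_mem V hV)
  killing K hK := hinv K (by rcases hK with rfl | rfl; exacts [hV, h𝔱.J_mem _ hV])
  holomorphic K hK := h𝔱.lieDeriv_J K (by rcases hK with rfl | rfl; exacts [hV, h𝔱.J_mem _ hV])

end FundamentalForm

noncomputable section Vaisman

/-! ### The Lee form and the Vaisman condition -/

variable {E : Type*} [NormedAddCommGroup E] [NormedSpace ℂ E] [FiniteDimensional ℂ E]
  {M : Type*} [TopologicalSpace M] [ChartedSpace E M] [IsManifold 𝓘(ℂ, E) ω M]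
  {g : Metric E M} {V : VField E M} {σ₁ σ₂ : M → ℝ} {θ : OneForm E M}

namespace IsInvariantPair

/-- The values of the Lee form on `V` and `J V`, from `dω(V, e, J e)` and `dω(J V, e, J e)` for a
horizontal vector `e`. -/
theorem leeForm_vertical [T2Space M] (P : IsInvariantPair g V) (hE : Module.finrank ℂ E = 2)
    (hσ₁ : ExtDerivEq (connForm g V) σ₁ (horForm g V (JField V)))
    (hσ₂ : ExtDerivEq (connForm g (JField V)) σ₂ (horForm g V (JField V)))
    (hθ : IsLeeForm g θ) (x : M) :
    θ x (V x) = -(g.inner x (V x) (V x) * σ₂ x) ∧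
      θ x (J x (V x)) = g.inner x (V x) (V x) * σ₁ x := by
  obtain ⟨e, he, hx⟩ := P.exists_isHorizontal hE x
  have hg := P.hermitian
  have hp := (g.pos x _ hx).ne'
  have e1 : g.inner x (V x) (e x) = 0 := by rw [g.symm, he.inner_V]
  have e2 : g.inner x (J x (V x)) (e x) = 0 := by rw [g.symm, he.inner_JV]
  have e3 : g.inner x (V x) (J x (e x)) = 0 := by
    have := hg.inner_J_left x (V x) (e x); rw [e2] at this; linarith
  have e4 := P.horForm_frame_right hE he hx (e x)
  have h1 := hθ.2 _ _ _ P.smooth he.smooth he.smooth_J x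
  have h2 := hθ.2 _ _ _ P.smooth.JField he.smooth he.smooth_J x
  rw [P.extDerivTwo_V he.smooth he.smooth_J, P.extDerivOne_inner (.inr rfl) he.smooth he.smooth_J,
    hσ₂ _ _ he.smooth he.smooth_J] at h1
  rw [P.extDerivTwo_JV he.smooth he.smooth_J, P.extDerivOne_inner (.inl rfl) he.smooth he.smooth_J,
    hσ₁ _ _ he.smooth he.smooth_J] at h2
  simp only [wedgeOneTwo, fundForm, connForm, JField, smul_apply, smul_eq_mul, hg x, e1, e2, e3,
    J_J, map_neg, neg_apply] at h1 h2
  rw [e4] at h1 h2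
  constructor
  · apply mul_right_cancel₀ hp; linarith
  · apply mul_right_cancel₀ hp; linarith

/-- A parallel Lee form forces `λ`, `σ₁` and `σ₂` to be constant. -/
theorem const_of_parallel_leeForm [T2Space M] [ConnectedSpace M] (P : IsInvariantPair g V) (hE : Module.finrank ℂ E = 2)
    (hs₂ : ContMDiff 𝓘(ℝ, E) 𝓘(ℝ, ℝ) ∞ σ₂)
    (hσ₁ : ExtDerivEq (connForm g V) σ₁ (horForm g V (JField V)))
    (hσ₂ : ExtDerivEq (connForm g (JField V)) σ₂ (horForm g V (JField V)))
    (hθ : IsLeeForm g θ) (hpar : IsParallelForm g θ) :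
    (∃ c : ℝ, ∀ x, g.inner x (V x) (V x) = c) ∧ (∃ c : ℝ, ∀ x, σ₁ x = c) ∧
      (∃ c : ℝ, ∀ x, σ₂ x = c) := by
  have hc : CompleteSpace E := FiniteDimensional.complete ℂ E
  obtain ⟨nabla, hLC, hpar⟩ := hpar
  have hv := P.leeForm_vertical hE hσ₁ hσ₂ hθ
  have hkos : ∀ {X Y Z : VField E M}, IsSmoothField X → IsSmoothField Y → IsSmoothField Z →
      ∀ x, 2 * g.inner x (nabla Y x (X x)) (Z x) = koszul g X Y Z x := fun hX hY hZ x =>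
    hLC.two_mul_inner (hX.diff x) (hY.diff x) (hZ.diff x)
  have hlam : ∀ X : VField E M, IsSmoothField X → ∀ x,
      dirDeriv X (fun y => g.inner y (V y) (V y)) x = 0 := by
    intro X hX x
    -- `∇_V V = -½ grad λ` is horizontal, so `λ θ(∇_V V) = dλ(∇_V V) = -2 |∇_V V|²`; on the other
    -- hand `θ(∇_V V) = V(θ(V)) = 0`, as `θ` is parallel and `θ(V) = -λ σ₂` is invariant.
    have h0 : θ x (nabla V x (V x)) = 0 := by
      rw [← hpar V V P.smooth P.smooth x]
      simp only [fun y => (hv y).1]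
      rw [show (fun y => -(g.inner y (V y) (V y) * σ₂ y)) =
          fun y => (-1) * (g.inner y (V y) (V y) * σ₂ y) from funext fun y => by ring,
        dirDeriv_const_mul V _ (f := fun y => g.inner y (V y) (V y) * σ₂ y)
          (smooth_diff (P.smooth_normSq.mul hs₂) x),
        dirDeriv_mul V (smooth_diff P.smooth_normSq x) (smooth_diff hs₂ x),
        P.dirDeriv_normSq (.inl rfl), P.dirDeriv_curvature hE (.inl rfl) (.inr rfl) hs₂ hσ₂]
      ring
    obtain ⟨U, hU, hUx⟩ := exists_smoothField (M := M) (x := x) (nabla V x (V x))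
    have h1 := hkos P.smooth P.smooth P.smooth x
    have h2 := hkos P.smooth P.smooth P.smooth.JField x
    have h3 := hkos P.smooth P.smooth hU x
    have h4 := hkos P.smooth P.smooth hX x
    rw [P.koszul_V_V P.smooth, P.dirDeriv_normSq (.inl rfl), g.symm] at h1
    rw [P.koszul_V_V P.smooth.JField, P.dirDeriv_normSq (.inr rfl), g.symm] at h2
    rw [P.koszul_V_V hU, P.dirDeriv_normSq_eq hθ hU, hUx, h0] at h3
    rw [P.koszul_V_V hX] at h4
    have h1' : g.inner x (V x) (nabla V x (V x)) = 0 := by linarith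
    have h2' : g.inner x (J x (V x)) (nabla V x (V x)) = 0 := by simp only [JField] at h2; linarith
    rw [h1', h2'] at h3
    have h5 : nabla V x (V x) = 0 := by
      by_contra hne
      have := g.pos x _ hne
      linarith
    rw [h5] at h4
    simp only [map_zero, zero_apply] at h4
    linarith
  have hVJ : ∀ y, g.inner y (V y) (JField V y) = 0 := fun y => inner_J_self P.hermitian y _
  have hJV : ∀ y, g.inner y (JField V y) (V y) = 0 := fun y => P.hermitian.inner_J_self_left y _
  have hJJ : ∀ y, g.inner y (JField V y) (JField V y) = g.inner y (V y) (V y) :=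
    fun y => P.hermitian y _ _
  have hθc : ∀ K, K = V ∨ K = JField V → ∃ c : ℝ, ∀ x, θ x (K x) = c := by
    intro K hK
    refine eq_const_of_dirDeriv_eq_zero (hθ.1.apply (P.smooth_of_mem hK)) fun X hX x => ?_
    rw [hpar X K hX (P.smooth_of_mem hK) x]
    -- Now that `λ` is constant, `∇_X K` is horizontal and `θ` vanishes on horizontal vectors.
    obtain ⟨W, hW, hWx⟩ := exists_smoothField (M := M) (x := x) (nabla K x (X x))
    have h1 := P.dirDeriv_normSq_eq hθ hW x
    have h2 := hkos hX (P.smooth_of_mem hK) P.smooth x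
    have h3 := hkos hX (P.smooth_of_mem hK) P.smooth.JField x
    rw [P.koszul_vertical_vertical hK (.inl rfl) hX, g.symm] at h2
    rw [P.koszul_vertical_vertical hK (.inr rfl) hX, g.symm] at h3
    have h2' : g.inner x (V x) (nabla K x (X x)) = 0 := by
      rcases hK with rfl | rfl
      · rw [hlam X hX] at h2; linarith
      · simp only [hJV, dirDeriv_const] at h2; linarith
    have h3' : g.inner x (J x (V x)) (nabla K x (X x)) = 0 := by
      change 2 * g.inner x (J x (V x)) (nabla K x (X x)) = _ at h3
      rcases hK with rfl | rfl
      · simp only [hVJ, dirDeriv_const] at h3; linarith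
      · simp only [hJJ, hlam X hX] at h3; linarith
    rw [hlam W hW, hWx, h2', h3'] at h1
    have h4 : g.inner x (V x) (V x) * θ x (nabla K x (X x)) = 0 := by linarith
    exact (mul_eq_zero.1 h4).resolve_left (P.pos x).ne'
  obtain ⟨c, hcl⟩ := eq_const_of_dirDeriv_eq_zero P.smooth_normSq hlam
  obtain ⟨a, ha⟩ := hθc V (.inl rfl)
  obtain ⟨b, hb⟩ := hθc (JField V) (.inr rfl)
  have hc0 : ∀ x : M, c ≠ 0 := fun x => hcl x ▸ (P.pos x).ne'
  refine ⟨⟨c, hcl⟩, ⟨b / c, fun x => ?_⟩, ⟨-a / c, fun x => ?_⟩⟩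
  · have h1 := (hv x).2
    rw [hcl x] at h1
    rw [eq_div_iff (hc0 x), ← hb x, mul_comm, ← h1]
    rfl
  · have h1 := (hv x).1
    rw [hcl x] at h1
    rw [eq_div_iff (hc0 x), ← ha x, mul_comm, h1, neg_neg]

section Constant

variable {c s₁ s₂ : ℝ}

/-- The Lee form if `λ`, `σ₁`, `σ₂` are constant. It is `g(T, ·)` with `T = σ₁ J V - σ₂ V`. -/
theorem isLeeForm_of_const [T2Space M] (P : IsInvariantPair g V) (hE : Module.finrank ℂ E = 2)
    (hc : ∀ x, g.inner x (V x) (V x) = c)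
    (hσ₁ : ExtDerivEq (connForm g V) (fun _ => s₁) (horForm g V (JField V)))
    (hσ₂ : ExtDerivEq (connForm g (JField V)) (fun _ => s₂) (horForm g V (JField V))) :
    IsLeeForm g (fun x => g.inner x (s₁ • J x (V x) - s₂ • V x)) := by
  have hcE : CompleteSpace E := FiniteDimensional.complete ℂ E
  have hg := P.hermitian
  have hT : IsSmoothField (fun x => s₁ • J x (V x) - s₂ • V x) :=
    (IsSmoothField.smul (f := fun _ => s₁) contMDiff_const P.smooth.JField).sub
      (IsSmoothField.smul (f := fun _ => s₂) contMDiff_const P.smooth)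
  refine ⟨isSmoothForm_inner g hT, fun X Y Z hX hY hZ x => ?_⟩
  set θ : OneForm E M := fun x => g.inner x (s₁ • J x (V x) - s₂ • V x) with hθ
  let D : VField E M → VField E M → VField E M → ℝ := fun X Y Z =>
    extDerivTwo (fundForm g) X Y Z x - wedgeOneTwo θ (fundForm g) X Y Z x
  have swl : ∀ X Y Z, D X Y Z = -D Y X Z := fun X Y Z => by
    simp only [D]
    rw [extDerivTwo_swap_left hg, wedgeOneTwo_swap_left hg]; ring
  have swr : ∀ X Y Z, D X Y Z = -D X Z Y := fun X Y Z => by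
    simp only [D]
    rw [extDerivTwo_swap_right hg, wedgeOneTwo_swap_right hg]; ring
  have d1 : ∀ u, g.inner x (V x) u = c * connForm g V x u := fun u => by
    rw [P.inner_eq_mul_connForm (.inl rfl), hc]
  have d2 : ∀ u, g.inner x (J x (V x)) u = c * connForm g (JField V) x u := fun u => by
    rw [← hc x, ← P.inner_eq_mul_connForm (.inr rfl)]; rfl
  have m := connForm_apply hg V x (P.ne_zero x)
  have D1 : ∀ {X Y}, IsSmoothField X → IsSmoothField Y → D V X Y = 0 := by
    intro X Y hX hY
    simp only [D, P.extDerivTwo_V hX hY,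
      P.extDerivOne_inner_of_const (.inr rfl) hc hσ₂ hX hY, P.horForm_eq, wedgeOneTwo, hθ,
      fundForm, map_sub, map_smul, sub_apply, smul_apply, smul_eq_mul, d1, d2, m]
    ring
  have D2 : ∀ {X Y}, IsSmoothField X → IsSmoothField Y → D (JField V) X Y = 0 := by
    intro X Y hX hY
    simp only [D, P.extDerivTwo_JV hX hY,
      P.extDerivOne_inner_of_const (.inl rfl) hc hσ₁ hX hY, P.horForm_eq, wedgeOneTwo, hθ,
      fundForm, map_sub, map_smul, sub_apply, smul_apply, smul_eq_mul, d1, d2,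
      show JField V x = J x (V x) from rfl, J_J, map_neg, neg_apply, m]
    ring
  obtain ⟨e, he, hx⟩ := P.exists_isHorizontal hE x
  have hpe := (g.pos x _ hx).ne'
  have exp := fun {X Y Z : VField E M} (hX : IsSmoothField X) (hY : IsSmoothField Y)
      (hZ : IsSmoothField Z) => (isTensorAt_extDerivTwo hg θ hX hY x).expand P hE he hZ
  have self : ∀ X Y, D X Y Y = 0 := fun X Y => by have := swr X Y Y; linarith
  have self' : ∀ X Y, D X Y X = 0 := fun X Y => by
    have h1 := swr X Y X
    have h2 := swl X X Y
    linarith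
  -- `D(X, Y, Z)` vanishes if one argument is vertical; a triple from `e, J e` has a repetition.
  have v1 : ∀ {X Y}, IsSmoothField X → IsSmoothField Y → D X Y V = 0 := fun hX hY => by
    rw [swr, swl, D1 hX hY]; simp
  have v2 : ∀ {X Y}, IsSmoothField X → IsSmoothField Y → D X Y (JField V) = 0 := fun hX hY => by
    rw [swr, swl, D2 hX hY]; simp
  have step1 : ∀ {Z}, IsSmoothField Z → D e (JField e) Z = 0 := by
    intro Z hZ
    have h : g.inner x (e x) (e x) * D e (JField e) Z = _ := exp he.smooth he.smooth_J hZ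
    change _ = _ * D e (JField e) V + _ * D e (JField e) (JField V)
      + _ * D e (JField e) e + _ * D e (JField e) (JField e) at h
    rw [v1 he.smooth he.smooth_J, v2 he.smooth he.smooth_J, self, self'] at h
    simpa [hpe] using h
  have step2 : ∀ {Y Z}, IsSmoothField Y → IsSmoothField Z →
      D e Y Z = 0 ∧ D (JField e) Y Z = 0 := by
    intro Y Z hY hZ
    have h : g.inner x (e x) (e x) * D e Z Y = _ := exp he.smooth hZ hY
    have h' : g.inner x (e x) (e x) * D (JField e) Z Y = _ := exp he.smooth_J hZ hY
    change _ = _ * D e Z V + _ * D e Z (JField V) + _ * D e Z e + _ * D e Z (JField e) at h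
    change _ = _ * D (JField e) Z V + _ * D (JField e) Z (JField V) + _ * D (JField e) Z e
      + _ * D (JField e) Z (JField e) at h'
    rw [v1 he.smooth hZ, v2 he.smooth hZ, self', swr e Z (JField e), step1 hZ] at h
    rw [v1 he.smooth_J hZ, v2 he.smooth_J hZ, self', swr (JField e) Z e, swl (JField e) e Z,
      step1 hZ] at h'
    constructor
    · rw [swr]; simpa [hpe] using h
    · rw [swr]; simpa [hpe] using h'
  have h : g.inner x (e x) (e x) * D X Y Z = _ := exp hX hY hZ
  change _ = _ * D X Y V + _ * D X Y (JField V) + _ * D X Y e + _ * D X Y (JField e) at h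
  rw [v1 hX hY, v2 hX hY, swr X Y e, swl X e, swr X Y (JField e), swl X (JField e),
    (step2 hX hY).1, (step2 hX hY).2] at h
  have h' : D X Y Z = 0 := by simpa [hpe] using h
  exact sub_eq_zero.1 h'

/-- `T = σ₁ J V - σ₂ V` is Killing, and the dual form `θ` is closed as
`dθ = λ (σ₁ σ₂ - σ₂ σ₁) ω̌`; so `T` is parallel. -/
theorem isParallelForm_of_const (P : IsInvariantPair g V)
    (hc : ∀ x, g.inner x (V x) (V x) = c)
    (hσ₁ : ExtDerivEq (connForm g V) (fun _ => s₁) (horForm g V (JField V)))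
    (hσ₂ : ExtDerivEq (connForm g (JField V)) (fun _ => s₂) (horForm g V (JField V))) :
    IsParallelForm g (fun x => g.inner x (s₁ • J x (V x) - s₂ • V x)) := by
  have hcE : CompleteSpace E := FiniteDimensional.complete ℂ E
  obtain ⟨nabla, hLC⟩ := exists_isLeviCivita g
  refine ⟨nabla, hLC, fun X Y hX hY x => ?_⟩
  have h1 := hLC.two_mul_inner (hX.diff x) (hY.diff x) (P.smooth.diff x)
  have h2 := hLC.two_mul_inner (hX.diff x) (hY.diff x) (P.smooth.JField.diff x)
  rw [P.koszul_vertical_right (.inl rfl) hX hY,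
    P.extDerivOne_inner_of_const (.inl rfl) hc hσ₁ hX hY, g.symm] at h1
  rw [P.koszul_vertical_right (.inr rfl) hX hY,
    P.extDerivOne_inner_of_const (.inr rfl) hc hσ₂ hX hY, g.symm] at h2
  have k1 := P.smooth.inner g hY
  have k2 := P.smooth.JField.inner g hY
  simp only [map_sub, map_smul, sub_apply, smul_apply, smul_eq_mul]
  change dirDeriv X (fun y => s₁ * g.inner y (JField V y) (Y y) - s₂ * g.inner y (V y) (Y y)) x =
    s₁ * g.inner x (JField V x) (nabla Y x (X x)) - s₂ * g.inner x (V x) (nabla Y x (X x))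
  rw [dirDeriv_sub X (f := fun y => s₁ * g.inner y (JField V y) (Y y))
    (h := fun y => s₂ * g.inner y (V y) (Y y)) (smooth_diff (contMDiff_const.mul k2) x)
    (smooth_diff (contMDiff_const.mul k1) x), dirDeriv_const_mul X _ (smooth_diff k2 x),
    dirDeriv_const_mul X _ (smooth_diff k1 x)]
  linear_combination (s₂ / 2) * h1 - (s₁ / 2) * h2

/-- If `σ₁ = σ₂ = 0`, then the Lee form vanishes and `g` is Kähler; otherwise it has no zeros. -/
theorem isVaisman_of_const [T2Space M] (P : IsInvariantPair g V) (hE : Module.finrank ℂ E = 2)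
    (hK : ¬ IsKaehler g) (hc : ∀ x, g.inner x (V x) (V x) = c)
    (hσ₁ : ExtDerivEq (connForm g V) (fun _ => s₁) (horForm g V (JField V)))
    (hσ₂ : ExtDerivEq (connForm g (JField V)) (fun _ => s₂) (horForm g V (JField V))) :
    IsVaisman g := by
  have hL := P.isLeeForm_of_const hE hc hσ₁ hσ₂
  refine ⟨_, hL, fun x h0 => hK ?_, P.isParallelForm_of_const hc hσ₁ hσ₂⟩
  have hp := (P.pos x).ne'
  have h1 := congrArg (fun f => f (V x)) h0
  have h2 := congrArg (fun f => f (J x (V x))) h0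
  simp only [map_sub, map_smul, sub_apply, smul_apply, smul_eq_mul, zero_apply, P.hermitian x,
    P.hermitian.inner_J_self_left, inner_J_self P.hermitian] at h1 h2
  have hs₂ : s₂ = 0 := by simpa [hp] using h1
  have hs₁ : s₁ = 0 := by simpa [hp] using h2
  intro X Y Z hX hY hZ y
  rw [hL.2 X Y Z hX hY hZ y]
  simp [wedgeOneTwo, hs₁, hs₂]

end Constant

end IsInvariantPair

end Vaisman

end VaismanSurface

open VaismanSurface
theorem proposition3p2
    {E : Type*} [NormedAddCommGroup E] [NormedSpace ℂ E] [FiniteDimensional ℂ E]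
    (hE : Module.finrank ℂ E = 2)
    {M : Type*} [TopologicalSpace M] [T2Space M] [CompactSpace M] [ConnectedSpace M]
    [ChartedSpace E M] [IsManifold 𝓘(ℂ, E) ω M]
    (𝔱 : Submodule ℝ (VField E M)) (h𝔱 : IsVerticalAlgebra 𝔱)
    (V : Module.Basis (Fin 2) ℝ 𝔱) (hV : JField (V 0 : VField E M) = V 1)
    (g : Metric E M) (hg : IsHermitianMetric g) (hinv : IsInvariantMetric 𝔱 g)
    (hK : ¬ IsKaehler g) :
    ∃ σ₁ σ₂ : M → ℝ,
      ContMDiff 𝓘(ℝ, E) 𝓘(ℝ, ℝ) ∞ σ₁ ∧ ContMDiff 𝓘(ℝ, E) 𝓘(ℝ, ℝ) ∞ σ₂ ∧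
      (∀ τ : M → ℝ, ExtDerivEq (connForm g (V 0)) τ (horForm g (V 0) (V 1)) ↔ τ = σ₁) ∧
      (∀ τ : M → ℝ, ExtDerivEq (connForm g (V 1)) τ (horForm g (V 0) (V 1)) ↔ τ = σ₂) ∧
      (IsVaisman g ↔
        (∃ c : ℝ, ∀ x, vertLength g (V 0) (V 1) x = c) ∧
        (∃ c : ℝ, ∀ x, σ₁ x = c) ∧ (∃ c : ℝ, ∀ x, σ₂ x = c)) := by
  have P := h𝔱.isInvariantPair hg hinv (V 0).2
    fun h => V.ne_zero 0 (Subtype.ext h)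
  rw [← hV]
  obtain ⟨σ₁, hs₁, hσ₁⟩ := P.exists_curvature hE (.inl rfl)
  obtain ⟨σ₂, hs₂, hσ₂⟩ := P.exists_curvature hE (.inr rfl)
  have hlam : ∀ x, vertLength g (V 0) (JField (V 0 : VField E M)) x =
      g.inner x ((V 0 : VField E M) x) ((V 0 : VField E M) x) := fun x => hg x _ _
  simp only [hlam]
  refine ⟨σ₁, σ₂, hs₁, hs₂, hσ₁, hσ₂, ?_, ?_⟩
  · rintro ⟨θ, hθ, -, hpar⟩
    exact P.const_of_parallel_leeForm hE hs₂ ((hσ₁ _).2 rfl) ((hσ₂ _).2 rfl) hθ hpar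
  · rintro ⟨⟨c, hc⟩, ⟨s₁, h₁⟩, ⟨s₂, h₂⟩⟩
    exact P.isVaisman_of_const hE hK hc ((hσ₁ _).2 (funext fun x => (h₁ x).symm))
      ((hσ₂ _).2 (funext fun x => (h₂ x).symm))
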